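/- **Definitions.** Matroids are on finite ground sets. An *interval positroid* is a matroid isomorphic to a matroid on $\{1,\dots,n\}$ whose matroid polytope is cut out of the hypersimplex $\Delta_{r,n}$ ($r$ the rank) by inequalities of the form $x_i+x_{i+1}+\dots+x_j\le k_{ij}$ with $i\le j$. An *excluded minor of interval positroids* is a matroid that is not an interval positroid while all its proper minors are. A matroid is *paving* if no circuit has fewer elements than the rank; its *edges* are its dependent hyperplanes. A *$d$-paving clutter* is a pair $(V,E)$ where $E$ is the set of edges of a paving matroid of rank $d\ge 2$ on $V$. A clutter $(V,E)$ is *interval* if $V$ can be linearly ordered so that every edge is a nonempty interval. For integers $0\le a,b\le d-3$, a $d$-paving clutter $(V,\{A,B,C\})$ is $Y_{a,b;d}$ *with common point $v$* (with its edges named $A,B,C$ in this order) if no vertex is isolated, $|A|=|B|=d\le |C|$, $|(A\cap C)\setminus B|=a$, $|(C\cap B)\setminus A|=b$, $(A\cap B)\setminus C=\emptyset$, $C\setminus(A\cup B)\neq\emptyset$, $A\cap B\cap C=\{v\}$, and $|C|>d$ only if $|C\setminus(A\cup B)|=1$. A clutter with three edges is $Y_{a,b;d}$ with common point $v$ if its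 edges can be named in this way. **Theorem.** Let $m\ge 3$ and let $M$ be a paving matroid of rank $d$ on a finite set $V$ whose dependent hyperplanes are exactly the $m+2$ distinct sets $A,B,C_1,\dots,C_m$. Let $v$ be given. Consider the following conditions on $(A,B,C_1,\dots,C_m)$ and integers $a_1,\dots,a_m,b_1,\dots,b_m$: 1. for every $i=1,\dots,m$ the partial clutter $(V,\{A,B,C_i\})$, with its edges named in this order, is $Y_{a_i,b_i;d}$ with common point $v$; 2. $(V\setminus\{v\},\{A\setminus\{v\},B\setminus\{v\},C_1\setminus\{v\},\dots,C_m\setminus\{v\}\})$ is an interval $(d-1)$-paving clutter. (i) Suppose that $M$ is an excluded minor of interval positroids, and let $a_1,b_1\ge 0$ be integers. Then the partial clutter $(V,\{A,B,C_1\})$ is $Y_{a_1,b_1;d}$ with common point $v$ if and only if, after a suitable renaming of the three edges $A,B,C_1$ among themselves, conditions 1 and 2 hold for these $a_1,b_1$ and some integers $a_2,\dots,a_m,b_2,\dots,b_m$. (ii) If conditions 1 and 2 hold for some integers $a_1,\dots,a_m,b_1,\dots,b_m$, then $M$ is an excluded minor of interval positroids. These excluded minors form the family $Y_{a_1,\dots,a_m,b_1,\dots,b_m;d}$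 (necessarily $a_i=|A\cap C_i|-1$ and $b_i=|B\cap C_i|-1$). -/

import Mathlib

open Set

/-! ## Hypergraphs: a vertex set `V` together with a set `E` of edges -/

/-- `(V, E)` is an interval hypergraph: some bijection between `V` and an initial segment of the
natural numbers turns every edge into a (nonempty) interval. -/
def IsIntervalHypergraph {α : Type*} (V : Set α) (E : Set (Set α)) : Prop :=
  ∃ (n : ℕ) (f : Fin n ≃ V), ∀ X ∈ E, ∃ i j : Fin n, i ≤ j ∧ X = (fun t => (f t : α)) '' Icc i j

/-- `(V, E)` is an interval clutter: an interval hypergraph with pairwise incomparable edges. -/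
def IsIntervalClutter {α : Type*} (V : Set α) (E : Set (Set α)) : Prop :=
  IsAntichain (· ⊆ ·) E ∧ IsIntervalHypergraph V E

/-! ## Interval positroids and their excluded minors -/

/-- The hypersimplex `Δ_{d,n}`. -/
def hypersimplex (d n : ℕ) : Set (Fin n → ℝ) :=
  {x | (∀ i, 0 ≤ x i ∧ x i ≤ 1) ∧ ∑ i, x i = d}

/-- The matroid polytope: the convex hull of the indicator vectors of the bases. -/
def matroidPolytope {n : ℕ} (N : Matroid (Fin n)) : Set (Fin n → ℝ) :=
  convexHull ℝ {x | ∃ B, N.IsBase B ∧ x = B.indicator 1}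

/-- An ordered interval positroid on `{1, …, n}`: its matroid polytope is cut out of the
hypersimplex by inequalities `x_i + ⋯ + x_j ≤ k i j` on intervals `[i, j]`. An interval on which no
inequality is imposed has the vacuous bound `k i j = n`. -/
def IsOrderedIntervalPositroid {n : ℕ} (N : Matroid (Fin n)) : Prop :=
  N.E = univ ∧ ∃ (d : ℕ) (k : Fin n → Fin n → ℕ), N.eRank = d ∧
    matroidPolytope N =
      {x | x ∈ hypersimplex d n ∧ ∀ i j : Fin n, i ≤ j → ∑ t ∈ Finset.Icc i j, x t ≤ k i j}

/-- An interval positroid: a matroid isomorphic to an ordered interval positroid. -/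
def IsIntervalPositroid {α : Type*} (M : Matroid α) : Prop :=
  ∃ (n : ℕ) (N : Matroid (Fin n)) (f : Fin n ↪ α),
    IsOrderedIntervalPositroid N ∧ M = N.mapEmbedding f

/-- An excluded minor of the class of interval positroids. -/
def IsExcludedMinorOfIntervalPositroids {α : Type*} (M : Matroid α) : Prop :=
  ¬ IsIntervalPositroid M ∧ ∀ N : Matroid α, N <m M → IsIntervalPositroid N

/-! ## Paving matroids and their clutters -/

/-- A matroid is paving if no circuit has fewer elements than the rank. -/
def IsPaving {α : Type*} (M : Matroid α) : Prop :=
  ∀ K, M.IsCircuit K → M.eRank ≤ K.encard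

/-- Hyperplanes: flats of rank one less than the rank of the matroid (of finite rank). -/
def IsHyperplane {α : Type*} (M : Matroid α) (H : Set α) : Prop :=
  M.IsFlat H ∧ M.eRk H + 1 = M.eRank

/-- The set of dependent hyperplanes; for a paving matroid, these are its edges. -/
def dependentHyperplanes {α : Type*} (M : Matroid α) : Set (Set α) :=
  {H | IsHyperplane M H ∧ M.Dep H}

/-- `(V, E)` is a `d`-paving clutter: the hypergraph of the dependent hyperplanes of a paving
matroid of rank `d ≥ 2` on the finite set `V`. -/
def IsPavingClutter {α : Type*} (d : ℕ) (V : Set α) (E : Set (Set α)) : Prop :=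
  2 ≤ d ∧ ∃ N : Matroid α, N.Finite ∧ N.E = V ∧ N.eRank = d ∧ IsPaving N ∧
    dependentHyperplanes N = E

/-! ## The clutters `Y_{a,b;d}` -/

/-- `(V, {A, B, C})` is the clutter `Y_{a,b;d}` with common point `v`, the edges `A`, `B`, `C` being
named as in the definition of `Y_{a,b;d}`. -/
structure IsLabelledY {α : Type*} (d a b : ℕ) (v : α) (V A B C : Set α) : Prop where
  pavingClutter : IsPavingClutter d V {A, B, C}
  a_le : a + 3 ≤ d
  b_le : b + 3 ≤ d
  no_isolated : ∀ x ∈ V, x ∈ A ∨ x ∈ B ∨ x ∈ C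
  card_A : A.ncard = d
  card_B : B.ncard = d
  card_C : d ≤ C.ncard
  card_AC : ((A ∩ C) \ B).ncard = a
  card_CB : ((C ∩ B) \ A).ncard = b
  card_AB : ((A ∩ B) \ C).ncard = 0
  card_C_only : 0 < (C \ (A ∪ B)).ncard
  card_ABC : (A ∩ B ∩ C).ncard = 1
  large : d < C.ncard → (C \ (A ∪ B)).ncard = 1
  common : v ∈ A ∩ B ∩ C

/-- The hypergraph `(V, E)` is the clutter `Y_{a,b;d}` with common point `v`: it has three edges,
and they can be named so that they fit the definition. -/
def IsY {α : Type*} (d a b : ℕ) (v : α) (V : Set α) (E : Set (Set α)) : Prop :=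
  ∃ A B C, E = {A, B, C} ∧ IsLabelledY d a b v V A B C

/-- The two conditions that define the family `Y_{a_1,…,a_m,b_1,…,b_m;d}` with edges
`A, B, C_1, …, C_m` and common point `v`. -/
def IsYFamily {α : Type*} {m : ℕ} (d : ℕ) (a b : Fin m → ℕ) (v : α) (V A B : Set α)
    (C : Fin m → Set α) : Prop :=
  (∀ i, IsLabelledY d (a i) (b i) v V A B (C i)) ∧
    IsIntervalClutter (V \ {v}) ((fun X => X \ {v}) '' ({A, B} ∪ range C)) ∧
    IsPavingClutter (d - 1) (V \ {v}) ((fun X => X \ {v}) '' ({A, B} ∪ range C))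

/-! Everything is reduced to linear orders. A finite matroid is an interval positroid exactly when,
for some order of its ground set, the ranks of the intervals determine the bases
(`IsIntervalDetermined`). In one direction a non-basis is cut off from the polytope by a linear
functional. In the other, a point of the polyhedron is the average of 0/1 points obtained by
rounding its partial sums with a common threshold. The property passes to minors, so only
one-element minors matter. For a paving matroid of rank d they have a simple test: after deleting x
the edges that keep at least d points must be intervals, and after contracting x the edges through x
must be intervals.

Two facts about intervals then do the work. Three intervals with a common point cannot all have
private points (`false_of_three_private`), which is why a clutter Y is not interval. An interval
meeting both differences of two intersecting intervals contains their intersection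
(`mem_of_mem_sdiff_of_mem_sdiff`).

Necessity: an edge D that misses v would contain all private points (`private_subset`), and counting
its points then ends in a parity contradiction (`common_mem`). Hence every edge contains v, and
contracting v orders all edges at once. The points outside A ∪ B can be assumed to lie between A and
B; otherwise C changes places with A or B, which is the renaming in the theorem. From this middle
position further deletions force every other edge into the shape of C
(`HasIntervalMinors.isLabelledY`).

Sufficiency: two incomparable sets C i already force the middle position (`exists_isMiddle_of_ne`).
Then v is reinserted on either side of the middle block, or between A and B with the middle block
moved to the end. For each one-element minor, one of these orders, or the order without v, passes
the test. -/

/-! ### Intervals of an order and matroids determined by their ranks -/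

section OrderConvex

variable {α : Type*}

/-- `X` is a subset of `E` that is convex in the order on `E` given by `p`. -/
def IsConvexIn (p : α → ℤ) (E X : Set α) : Prop :=
  X ⊆ E ∧ ∀ x ∈ X, ∀ y ∈ X, ∀ z ∈ E, p x ≤ p z → p z ≤ p y → z ∈ X

/-- The bases of `M` are determined by their sizes and the ranks of the intervals of an order. -/
def IsIntervalDetermined (M : Matroid α) : Prop :=
  ∃ p : α → ℤ, InjOn p M.E ∧ ∀ B ⊆ M.E, B.encard = M.eRank →
    (∀ X, IsConvexIn p M.E X → ∃ B', M.IsBase B' ∧ (B ∩ X).ncard ≤ (B' ∩ X).ncard) → M.IsBase B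

end OrderConvex

/-! ### Rounding a fractional vector to 0/1 vectors -/

section Rounding

variable {n : ℕ}

lemma sum_Icc_indicator_one (B : Set (Fin n)) (s : Finset (Fin n)) :
    ∑ t ∈ s, B.indicator (1 : Fin n → ℝ) t = ((B ∩ s).ncard : ℝ) := by
  classical
  have : (B ∩ s : Set (Fin n)) = ((s.filter (· ∈ B) : Finset (Fin n)) : Set (Fin n)) := by
    ext; simp [and_comm]
  rw [this, ncard_coe_finset, Finset.card_filter]
  push_cast
  exact Finset.sum_congr rfl fun x _ => by simp [indicator_apply]

/-- The partial sums of a vector. -/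
noncomputable def partialSum (x : Fin n → ℝ) (t : ℕ) : ℝ :=
  ∑ i ∈ Finset.range t, if h : i < n then x ⟨i, h⟩ else 0

lemma partialSum_succ (x : Fin n → ℝ) (i : Fin n) :
    partialSum x (i + 1) = partialSum x i + x i := by
  simp [partialSum, Finset.sum_range_succ]

lemma sum_Icc_eq_sub (F : ℕ → ℝ) (x : Fin n → ℝ) (hx : ∀ i : Fin n, x i = F (i + 1) - F i)
    (i j : Fin n) (hij : i ≤ j) : ∑ t ∈ Finset.Icc i j, x t = F (j + 1) - F i := by
  have h1 : ∑ t ∈ Finset.Icc i j, x t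
      = ∑ t ∈ (Finset.Icc i j).map Fin.valEmbedding, (F (t + 1) - F t) := by
    rw [Finset.sum_map]
    exact Finset.sum_congr rfl fun t _ => hx t
  have hij' : (i : ℕ) ≤ j := hij
  rw [h1, Fin.map_valEmbedding_Icc, ← Finset.Ico_add_one_right_eq_Icc,
    Finset.sum_Ico_eq_sum_range]
  have h2 := Finset.sum_range_sub (fun t => F (i + t)) (j + 1 - i)
  rw [show (i : ℕ) + (j + 1 - i) = j + 1 by omega] at h2
  simpa [add_assoc] using h2

lemma sum_univ_eq_sub (F : ℕ → ℝ) (x : Fin n → ℝ) (hx : ∀ i : Fin n, x i = F (i + 1) - F i) :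
    ∑ t, x t = F n - F 0 := by
  rw [← Finset.sum_range_sub, Finset.sum_range]
  exact Finset.sum_congr rfl fun t _ => hx t

/-- Random rounding of the partial sums, with threshold `θ`. -/
noncomputable def roundedVector (x : Fin n → ℝ) (θ : ℝ) (i : Fin n) : ℝ :=
  ((⌊partialSum x (i + 1) + θ⌋ : ℤ) : ℝ) - ((⌊partialSum x i + θ⌋ : ℤ) : ℝ)

/-- The fractional part has period 1, so its mean over a unit interval does not change under shifts;
the two fractional parts cancel and only s - t survives. -/
lemma integral_floor_sub (s t : ℝ) :
    ∫ θ in Ioc (0 : ℝ) 1, (((⌊s + θ⌋ : ℤ) : ℝ) - ((⌊t + θ⌋ : ℤ) : ℝ)) = s - t := by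
  have key : ∀ u : ℝ, ∫ θ in (0 : ℝ)..1, Int.fract (u + θ) = ∫ θ in (0 : ℝ)..1, Int.fract θ := by
    intro u
    have hp : Function.Periodic (Int.fract : ℝ → ℝ) 1 := fun x => Int.fract_add_one x
    have := hp.intervalIntegral_add_eq u 0
    rw [intervalIntegral.integral_comp_add_left (fun θ => Int.fract θ) u]
    simpa using this
  have hi : ∀ u : ℝ, IntervalIntegrable (fun θ => Int.fract (u + θ)) MeasureTheory.volume 0 1 := by
    intro u
    refine (intervalIntegrable_const (c := (1 : ℝ))).mono_fun ?_ ?_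
    · exact ((measurable_fract).comp (measurable_const_add u)).aestronglyMeasurable
    · refine Filter.Eventually.of_forall fun θ => ?_
      change ‖Int.fract (u + θ)‖ ≤ ‖(1 : ℝ)‖
      rw [norm_one, Real.norm_eq_abs, abs_of_nonneg (Int.fract_nonneg (u + θ))]
      exact (Int.fract_lt_one _).le
  rw [← intervalIntegral.integral_of_le zero_le_one]
  have : ∀ θ : ℝ, ((⌊s + θ⌋ : ℤ) : ℝ) - ((⌊t + θ⌋ : ℤ) : ℝ)
      = (s - t) + (Int.fract (t + θ) - Int.fract (s + θ)) := by
    intro θ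
    rw [Int.fract, Int.fract]; ring
  simp_rw [this]
  rw [intervalIntegral.integral_add (by simp) ((hi t).sub (hi s)),
    intervalIntegral.integral_sub (hi t) (hi s), key, key]
  simp

lemma roundedVector_mem (x : Fin n → ℝ) (hx : ∀ i, 0 ≤ x i ∧ x i ≤ 1) (θ : ℝ) (i : Fin n) :
    roundedVector x θ i = 0 ∨ roundedVector x θ i = 1 := by
  have h1 : ⌊partialSum x i + θ⌋ ≤ ⌊partialSum x (i + 1) + θ⌋ := by
    apply Int.floor_le_floor
    rw [partialSum_succ]; linarith [(hx i).1]
  have h2 : ⌊partialSum x (i + 1) + θ⌋ ≤ ⌊partialSum x i + θ⌋ + 1 := by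
    rw [← Int.floor_add_one]
    apply Int.floor_le_floor
    rw [partialSum_succ]; linarith [(hx i).2]
  unfold roundedVector
  rcases (by omega : ⌊partialSum x (i + 1) + θ⌋ = ⌊partialSum x i + θ⌋ ∨
    ⌊partialSum x (i + 1) + θ⌋ = ⌊partialSum x i + θ⌋ + 1) with h | h <;> rw [h] <;> simp

/-- For θ uniform in (0, 1] the expectation of the rounding is `x`, and the closed convex hull of a
finite set contains the mean of any random point of that set. -/
lemma mem_convexHull_of_roundedVector_mem (x : Fin n → ℝ) (hx : ∀ i, 0 ≤ x i ∧ x i ≤ 1)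
    (s : Set (Fin n → ℝ)) (hs : s.Finite) (h : ∀ θ, roundedVector x θ ∈ s) :
    x ∈ convexHull ℝ s := by
  have hm : ∀ i, Measurable fun θ => roundedVector x θ i := by
    intro i
    unfold roundedVector
    fun_prop
  have hint : ∀ i, MeasureTheory.Integrable (fun θ => roundedVector x θ i)
      (MeasureTheory.volume.restrict (Ioc (0 : ℝ) 1)) := by
    intro i
    refine (MeasureTheory.integrable_const (1 : ℝ)).mono' (hm i).aestronglyMeasurable ?_
    refine Filter.Eventually.of_forall fun θ => ?_
    rcases roundedVector_mem x hx θ i with h | h <;> simp [h]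
  have hint' : MeasureTheory.Integrable (fun θ => roundedVector x θ)
      (MeasureTheory.volume.restrict (Ioc (0 : ℝ) 1)) := MeasureTheory.Integrable.of_eval hint
  have : MeasureTheory.IsProbabilityMeasure (MeasureTheory.volume.restrict (Ioc (0 : ℝ) 1)) :=
    ⟨by simp⟩
  have hmem := (convex_convexHull ℝ s).integral_mem (hs.isClosed_convexHull ℝ)
    (Filter.Eventually.of_forall fun θ => subset_convexHull ℝ s (h θ)) hint'
  convert hmem using 1
  funext i
  rw [MeasureTheory.eval_integral hint]
  simp only [roundedVector]
  rw [integral_floor_sub, partialSum_succ]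
  ring

lemma sum_Icc_roundedVector (x : Fin n → ℝ) (θ : ℝ) (i j : Fin n) (hij : i ≤ j) :
    ∑ t ∈ Finset.Icc i j, roundedVector x θ t
      = ((⌊partialSum x (j + 1) + θ⌋ - ⌊partialSum x i + θ⌋ : ℤ) : ℝ) := by
  rw [sum_Icc_eq_sub (fun t => ((⌊partialSum x t + θ⌋ : ℤ) : ℝ)) (roundedVector x θ) (fun _ => rfl) i j hij]
  push_cast
  rfl

/-- The sum over an interval is a difference of two partial sums, and the floor commutes with adding
the integer `k`; hence integral interval bounds survive rounding for every θ. -/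
lemma sum_Icc_roundedVector_le (x : Fin n → ℝ) (θ : ℝ) (i j : Fin n) (hij : i ≤ j) (k : ℕ)
    (h : ∑ t ∈ Finset.Icc i j, x t ≤ k) : ∑ t ∈ Finset.Icc i j, roundedVector x θ t ≤ k := by
  rw [sum_Icc_roundedVector x θ i j hij]
  rw [sum_Icc_eq_sub (partialSum x) x (fun i => by rw [partialSum_succ]; ring) i j hij] at h
  have : ⌊partialSum x (j + 1) + θ⌋ ≤ ⌊partialSum x i + θ⌋ + (k : ℤ) := by
    rw [← Int.floor_add_natCast]
    apply Int.floor_le_floor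
    linarith
  have h3 : ⌊partialSum x (j + 1) + θ⌋ - ⌊partialSum x i + θ⌋ ≤ (k : ℤ) := by omega
  exact_mod_cast h3

lemma sum_univ_roundedVector (x : Fin n → ℝ) (θ : ℝ) (d : ℕ) (h : ∑ t, x t = d) :
    ∑ t, roundedVector x θ t = d := by
  rw [sum_univ_eq_sub (partialSum x) x (fun i => by rw [partialSum_succ]; ring)] at h
  rw [sum_univ_eq_sub (fun t => ((⌊partialSum x t + θ⌋ : ℤ) : ℝ)) (roundedVector x θ) (fun _ => rfl)]
  rw [show partialSum x n + θ = (partialSum x 0 + θ) + (d : ℕ) by linarith,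
    Int.floor_add_natCast]
  push_cast
  ring

end Rounding

/-! ### Interval positroids are the interval-determined matroids -/

section Positroid

variable {α : Type*}

lemma exists_isBase_encard_inter_eq_eRk (N : Matroid α) (X : Set α) :
    ∃ B, N.IsBase B ∧ (B ∩ X).encard = N.eRk X := by
  obtain ⟨I, hI⟩ := N.exists_isBasis' X
  obtain ⟨B, hB, hIB⟩ := hI.indep.exists_isBase_superset
  refine ⟨B, hB, ?_⟩
  rw [← hI.encard_eq_eRk]
  congr 1
  refine Subset.antisymm ?_ (subset_inter hIB hI.subset)
  rw [hI.eq_of_subset_indep (hB.indep.subset inter_subset_left) (subset_inter hIB hI.subset)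
    inter_subset_right]

/-- The bound `k i j` is at least the count of any basis on [i, j], so the indicator of `B`
satisfies all inequalities and lies in the polytope; a 0/1 point there has to be a vertex. -/
lemma IsOrderedIntervalPositroid.isBase_of_forall_Icc {n : ℕ} {N : Matroid (Fin n)}
    (hN : IsOrderedIntervalPositroid N) {B : Set (Fin n)} (hB : B.encard = N.eRank)
    (h : ∀ i j, i ≤ j → ∃ B', N.IsBase B' ∧ (B ∩ Icc i j).ncard ≤ (B' ∩ Icc i j).ncard) :
    N.IsBase B := by
  classical
  obtain ⟨hE, d, k, hd, hP⟩ := hN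
  have hBd : ∀ B : Set (Fin n), B.encard = N.eRank → B.ncard = d := by
    intro B hB; rw [ncard, hB, hd]; rfl
  have hmem : B.indicator 1 ∈ matroidPolytope N := by
    rw [hP]
    refine ⟨⟨fun i => by by_cases hi : i ∈ B <;> simp [hi], ?_⟩, fun i j hij => ?_⟩
    · rw [sum_Icc_indicator_one B Finset.univ]
      simp [hBd B hB]
    · obtain ⟨B', hB', hle⟩ := h i j hij
      have h1 : B'.indicator 1 ∈ matroidPolytope N := subset_convexHull _ _ ⟨B', hB', rfl⟩
      rw [hP] at h1
      have h2 := h1.2 i j hij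
      rw [sum_Icc_indicator_one] at h2 ⊢
      rw [Finset.coe_Icc] at *
      exact le_trans (by exact_mod_cast hle) h2
  by_contra hnb
  -- A basis other than `B` misses a point of `B`, so the coordinate sum over `B` is at most d - 1
  -- on the polytope, but it is d at the indicator of `B`.
  have hsub : matroidPolytope N ⊆ {x | ∑ t ∈ B.toFinset, x t ≤ (d : ℝ) - 1} := by
    refine convexHull_min ?_ ?_
    · rintro x ⟨B', hB', rfl⟩
      simp only [mem_ofPred_eq]
      rw [sum_Icc_indicator_one]
      have h1 : (B' ∩ B).ncard < B.ncard := by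
        refine ncard_lt_ncard ⟨inter_subset_right, fun hs => hnb ?_⟩ (toFinite _)
        have : B = B' := eq_of_subset_of_ncard_le (fun b hb => (hs hb).1)
          (by rw [hBd B hB, hBd B' hB'.encard_eq_eRank]) (toFinite _)
        rwa [this]
      rw [hBd B hB] at h1
      have : (B' ∩ B).ncard + 1 ≤ d := h1
      have : ((B' ∩ B).ncard : ℝ) + 1 ≤ d := by exact_mod_cast this
      simp only [coe_toFinset]
      linarith
    · exact convex_halfSpace_le ⟨fun x y => by simp [Finset.sum_add_distrib],
        fun c x => by simp [Finset.mul_sum]⟩ _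
  have := hsub hmem
  simp only [mem_ofPred_eq] at this
  rw [sum_Icc_indicator_one] at this
  simp only [coe_toFinset, inter_self, hBd B hB] at this
  linarith

/-- The ranks of the intervals serve as bounds. Each rounding of a point of the polyhedron obeys the
same bounds, so by hypothesis it is the indicator of a basis. -/
lemma isOrderedIntervalPositroid_of_forall_Icc {n : ℕ} {N : Matroid (Fin n)} (hE : N.E = univ)
    (h : ∀ B : Set (Fin n), B.encard = N.eRank →
      (∀ i j, i ≤ j → ∃ B', N.IsBase B' ∧ (B ∩ Icc i j).ncard ≤ (B' ∩ Icc i j).ncard) →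
      N.IsBase B) : IsOrderedIntervalPositroid N := by
  classical
  obtain ⟨B₀, hB₀⟩ := N.exists_isBase
  have hd : N.eRank = B₀.ncard := by
    rw [← hB₀.encard_eq_eRank, (toFinite B₀).cast_ncard_eq]
  refine ⟨hE, B₀.ncard, fun i j => (N.eRk (Icc i j)).toNat, hd, ?_⟩
  have hfin : ∀ X : Set (Fin n), ((N.eRk X).toNat : ℕ∞) = N.eRk X := fun X =>
    ENat.natCast_toNat (ne_top_of_le_ne_top (toFinite X).encard_lt_top.ne (N.eRk_le_encard X))
  apply Subset.antisymm
  · refine convexHull_min ?_ ?_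
    · rintro x ⟨B, hB, rfl⟩
      refine ⟨⟨fun i => by by_cases hi : i ∈ B <;> simp [hi], ?_⟩, fun i j hij => ?_⟩
      · rw [sum_Icc_indicator_one B Finset.univ]
        have h1 : (B.ncard : ℕ∞) = B₀.ncard := by
          rw [← hd, ← hB.encard_eq_eRank, (toFinite B).cast_ncard_eq]
        have : B.ncard = B₀.ncard := by exact_mod_cast h1
        simp [this]
      · rw [sum_Icc_indicator_one, Finset.coe_Icc]
        have h1 : ((B ∩ Icc i j).ncard : ℕ∞) ≤ (N.eRk (Icc i j)).toNat := by
          rw [hfin, (toFinite _).cast_ncard_eq]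
          exact (hB.indep.subset inter_subset_left).encard_le_eRk_of_subset inter_subset_right
        have : (B ∩ Icc i j).ncard ≤ (N.eRk (Icc i j)).toNat := by exact_mod_cast h1
        exact_mod_cast this
    · rintro x ⟨⟨hx1, hx2⟩, hx3⟩ y ⟨⟨hy1, hy2⟩, hy3⟩ a b ha hb hab
      have hlin : ∀ s : Finset (Fin n), ∑ t ∈ s, (a • x + b • y) t
          = a * ∑ t ∈ s, x t + b * ∑ t ∈ s, y t := fun s => by
        simp [Finset.sum_add_distrib, Finset.mul_sum]
      refine ⟨⟨fun i => ⟨?_, ?_⟩, ?_⟩, fun i j hij => ?_⟩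
      · have := (hx1 i).1; have := (hy1 i).1
        simp only [Pi.add_apply, Pi.smul_apply, smul_eq_mul]; positivity
      · simp only [Pi.add_apply, Pi.smul_apply, smul_eq_mul]
        nlinarith [(hx1 i).2, (hy1 i).2]
      · rw [hlin, hx2, hy2, ← add_mul, hab, one_mul]
      · rw [hlin]
        have h1 := mul_le_mul_of_nonneg_left (hx3 i j hij) ha
        have h2 := mul_le_mul_of_nonneg_left (hy3 i j hij) hb
        calc _ ≤ _ := add_le_add h1 h2
          _ = _ := by rw [← add_mul, hab, one_mul]
  · rintro x ⟨⟨hx1, hx2⟩, hx3⟩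
    have hbf : {x : Fin n → ℝ | ∃ B, N.IsBase B ∧ x = B.indicator 1}.Finite :=
      (finite_range fun B : Set (Fin n) => B.indicator (1 : Fin n → ℝ)).subset
        fun x ⟨B, _, hx⟩ => ⟨B, hx.symm⟩
    refine mem_convexHull_of_roundedVector_mem x hx1 _ hbf fun θ => ?_
    have hr : roundedVector x θ = {i | roundedVector x θ i = 1}.indicator 1 := by
      funext i
      rcases roundedVector_mem x hx1 θ i with h0 | h0 <;> simp [h0]
    refine ⟨_, h _ ?_ fun i j hij => ?_, hr⟩
    · have h1 := sum_univ_roundedVector x θ _ hx2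
      rw [hr, sum_Icc_indicator_one] at h1
      rw [hd, ← (toFinite _).cast_ncard_eq]
      have h2 : {i | roundedVector x θ i = 1}.ncard = B₀.ncard := by simpa using h1
      rw [h2]
    · obtain ⟨B', hB', hr'⟩ := exists_isBase_encard_inter_eq_eRk N (Icc i j)
      refine ⟨B', hB', ?_⟩
      have h1 := sum_Icc_roundedVector_le x θ i j hij _ (hx3 i j hij)
      simp only [] at h1
      rw [hr, sum_Icc_indicator_one, ← hr', Finset.coe_Icc] at h1
      exact_mod_cast h1

lemma IsIntervalPositroid.isIntervalDetermined {M : Matroid α} (hM : IsIntervalPositroid M) :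
    IsIntervalDetermined M := by
  classical
  obtain ⟨n, N, f, hN, rfl⟩ := hM
  have hp : ∀ i, (Function.extend f (fun i : Fin n => ((i : ℕ) : ℤ)) 0) (f i) = ((i : ℕ) : ℤ) :=
    fun i => f.injective.extend_apply _ _ _
  refine ⟨Function.extend f (fun i : Fin n => ((i : ℕ) : ℤ)) 0, ?_, fun B hB hBc h => ?_⟩
  · rw [Matroid.mapEmbedding_ground_eq]
    rintro _ ⟨i, -, rfl⟩ _ ⟨j, -, rfl⟩ hij
    rw [hp, hp] at hij
    rw [Fin.ext (by exact_mod_cast hij : (i : ℕ) = j)]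
  · rw [Matroid.mapEmbedding_ground_eq] at hB
    obtain ⟨B, -, rfl⟩ := subset_image_iff.1 hB
    refine (Matroid.IsBase.mapEmbedding (hN.isBase_of_forall_Icc ?_ fun i j hij => ?_) f)
    · rw [f.injective.encard_image] at hBc
      rw [hBc, Matroid.mapEmbedding, Matroid.eRank_map]
    · have hconv : IsConvexIn (Function.extend f (fun i : Fin n => ((i : ℕ) : ℤ)) 0)
          (N.mapEmbedding f).E (f '' Icc i j) := by
        refine ⟨?_, ?_⟩
        · rw [Matroid.mapEmbedding_ground_eq, hN.1]
          exact image_mono (subset_univ _)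
        · rintro _ ⟨x, hx, rfl⟩ _ ⟨y, hy, rfl⟩ z hz hxz hzy
          rw [Matroid.mapEmbedding_ground_eq] at hz
          obtain ⟨z, -, rfl⟩ := hz
          rw [hp, hp] at hxz hzy
          refine mem_image_of_mem _ ⟨hx.1.trans ?_, le_trans ?_ hy.2⟩
          · rw [Fin.le_def]; exact_mod_cast hxz
          · rw [Fin.le_def]; exact_mod_cast hzy
      obtain ⟨B', hB', hle⟩ := h _ hconv
      rw [Matroid.mapEmbedding_isBase_iff] at hB'
      obtain ⟨hB', hr⟩ := hB'
      obtain ⟨B', rfl⟩ := subset_range_iff_exists_image_eq.1 hr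
      rw [preimage_image_eq _ f.injective] at hB'
      refine ⟨B', hB', ?_⟩
      rwa [← image_inter f.injective, ← image_inter f.injective,
        ncard_image_of_injective _ f.injective, ncard_image_of_injective _ f.injective] at hle

/-- The ground set is relabelled by position in the order, which turns each convex set into a set
[i, j] or into the empty set; the latter imposes nothing. -/
lemma IsIntervalDetermined.isIntervalPositroid {M : Matroid α} [M.Finite]
    (hM : IsIntervalDetermined M) : IsIntervalPositroid M := by
  classical
  obtain ⟨p, hp, h⟩ := hM
  have hfin := M.ground_finite
  set S : Finset ℤ := hfin.toFinset.image p with hS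
  have hex : ∀ i : Fin S.card, ∃ x ∈ M.E, p x = S.orderEmbOfFin rfl i := by
    intro i
    have := S.orderEmbOfFin_mem rfl i
    obtain ⟨x, hx, hxi⟩ := Finset.mem_image.1 this
    exact ⟨x, by simpa using hx, hxi⟩
  choose f hfE hpf using hex
  have hmono : StrictMono fun i => p (f i) := by
    intro i j hij
    simp only [hpf]
    exact (S.orderEmbOfFin rfl).strictMono hij
  have hinj : Function.Injective f := fun i j hij => hmono.injective (by simp [hij])
  have hsurj : ∀ x ∈ M.E, ∃ i, f i = x := by
    intro x hx
    have : p x ∈ range (S.orderEmbOfFin rfl) := by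
      rw [Finset.range_orderEmbOfFin]; simp only [hS, Finset.coe_image]
      exact ⟨x, by simpa using hx, rfl⟩
    obtain ⟨i, hi⟩ := this
    exact ⟨i, hp (hfE i) hx (by rw [hpf, hi])⟩
  have hr : range f = M.E := Subset.antisymm (range_subset_iff.2 hfE) hsurj
  have hME : M = (M.comap f).mapEmbedding ⟨f, hinj⟩ :=
    (Matroid.map_comap (by rw [hr]) hinj.injOn).symm
  have hbase : ∀ B, (M.comap f).IsBase B ↔ M.IsBase (f '' B) := by
    intro B
    conv_rhs => rw [hME, Matroid.mapEmbedding_isBase_iff]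
    simp only [Function.Embedding.coeFn_mk]
    rw [preimage_image_eq _ hinj]
    simp
  have hrank : (M.comap f).eRank = M.eRank := by
    conv_rhs => rw [hME, Matroid.mapEmbedding, Matroid.eRank_map]
  refine ⟨_, M.comap f, ⟨f, hinj⟩, isOrderedIntervalPositroid_of_forall_Icc ?_ ?_, hME⟩
  · rw [Matroid.comap_ground_eq, ← hr, preimage_range]
  intro B hB hIcc
  rw [hbase]
  refine h _ (by rw [← hr]; exact image_subset_range _ _) ?_ fun X hX => ?_
  · rw [hinj.encard_image, hB, hrank]
  have himg : ∀ (B : Set (Fin S.card)), ((f '' B) ∩ X).ncard = (B ∩ f ⁻¹' X).ncard := by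
    intro B
    rw [← image_inter_preimage, ncard_image_of_injective _ hinj]
  rcases (f ⁻¹' X).eq_empty_or_nonempty with he | hne
  · obtain ⟨B', hB'⟩ := M.exists_isBase
    exact ⟨B', hB', by rw [himg, he]; simp⟩
  have hne' : (f ⁻¹' X).toFinset.Nonempty := by simpa using hne
  set i := (f ⁻¹' X).toFinset.min' hne'
  set j := (f ⁻¹' X).toFinset.max' hne'
  have hi : f i ∈ X := by simpa using (f ⁻¹' X).toFinset.min'_mem hne'
  have hj : f j ∈ X := by simpa using (f ⁻¹' X).toFinset.max'_mem hne'
  have hXI : f ⁻¹' X = Icc i j := by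
    ext t
    constructor
    · intro ht
      exact ⟨Finset.min'_le _ _ (by simpa using ht), Finset.le_max' _ _ (by simpa using ht)⟩
    · intro ht
      exact hX.2 _ hi _ hj _ (hfE t) (hmono.monotone ht.1) (hmono.monotone ht.2)
  obtain ⟨B', hB', hle⟩ := hIcc i j (Finset.min'_le_max' _ hne')
  exact ⟨f '' B', (hbase _).1 hB', by rw [himg, himg, hXI]; exact hle⟩

end Positroid

/-! ### Closure under minors -/

section Minors

open scoped Matroid

variable {α : Type*} {M N : Matroid α}

lemma IsConvexIn.inter_of_subset {p : α → ℤ} {E E' X : Set α} (hX : IsConvexIn p E X)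
    (hE : E' ⊆ E) : IsConvexIn p E' (X ∩ E') :=
  ⟨inter_subset_right, fun x hx y hy z hz h1 h2 => ⟨hX.2 x hx.1 y hy.1 z (hE hz) h1 h2, hz⟩⟩

/-- The order is kept. Adding `x` to a basis of the contraction and to the candidate changes both
counts on an interval by the same amount. -/
lemma IsIntervalDetermined.contractElem_of_isNonloop [M.Finite] (hM : IsIntervalDetermined M)
    {x : α} (hx : M.IsNonloop x) : IsIntervalDetermined (M ／ {x}) := by
  obtain ⟨p, hp, h⟩ := hM
  have hI := hx.indep
  have hxE := hx.mem_ground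
  obtain ⟨B₀, hB₀⟩ := (M ／ {x}).exists_isBase
  have hrank : M.eRank = (M ／ {x}).eRank + 1 := by
    rw [← hB₀.encard_eq_eRank]
    rw [hI.contract_isBase_iff] at hB₀
    rw [← hB₀.1.encard_eq_eRank, encard_union_eq hB₀.2, encard_singleton]
  refine ⟨p, hp.mono sdiff_subset, fun B hB hBc hX => ?_⟩
  have hBx : Disjoint B {x} := (subset_sdiff.1 hB).2
  rw [hI.contract_isBase_iff]
  refine ⟨h _ ?_ ?_ fun X hXc => ?_, hBx⟩
  · exact union_subset (hB.trans sdiff_subset) (singleton_subset_iff.2 hxE)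
  · rw [encard_union_eq hBx, encard_singleton, hBc, hrank]
  · obtain ⟨B', hB', hle⟩ := hX _ (hXc.inter_of_subset (E' := M.E \ {x}) sdiff_subset)
    rw [hI.contract_isBase_iff] at hB'
    refine ⟨_, hB'.1, ?_⟩
    have hfin : ∀ Y : Set α, (({x} : Set α) ∩ Y).Finite := fun Y =>
      (finite_singleton x).subset inter_subset_left
    have aux : ∀ B : Set α, B ⊆ M.E → Disjoint B {x} →
        ((B ∪ {x}) ∩ X).ncard = (B ∩ (X ∩ (M.E \ {x}))).ncard + (({x} : Set α) ∩ X).ncard := by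
      intro B hB hd
      rw [union_inter_distrib_right, ncard_union_eq
        (hd.mono inter_subset_left inter_subset_left)
        ((M.ground_finite.subset hB).subset inter_subset_left) (hfin X)]
      congr 2
      ext y
      constructor
      · exact fun hy => ⟨hy.1, hy.2, hB hy.1, disjoint_left.1 hd hy.1⟩
      · exact fun hy => ⟨hy.1, hy.2.1⟩
    rw [aux B (hB.trans sdiff_subset) hBx,
      aux B' (subset_union_left.trans hB'.1.subset_ground) hB'.2]
    omega

lemma IsIntervalDetermined.deleteElem_of_not_isColoop (hM : IsIntervalDetermined M)
    {x : α} (hx : M.Coindep {x}) : IsIntervalDetermined (M ＼ {x}) := by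
  obtain ⟨p, hp, h⟩ := hM
  obtain ⟨B₀, hB₀⟩ := (M ＼ {x}).exists_isBase
  have hrank : M.eRank = (M ＼ {x}).eRank := by
    rw [← hB₀.encard_eq_eRank]
    rw [hx.delete_isBase_iff] at hB₀
    rw [← hB₀.1.encard_eq_eRank]
  refine ⟨p, hp.mono sdiff_subset, fun B hB hBc hX => ?_⟩
  have hBx : Disjoint B {x} := (subset_sdiff.1 hB).2
  rw [hx.delete_isBase_iff]
  refine ⟨h _ (hB.trans sdiff_subset) (hBc.trans hrank.symm) fun X hXc => ?_, hBx⟩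
  obtain ⟨B', hB', hle⟩ := hX _ (hXc.inter_of_subset (E' := M.E \ {x}) sdiff_subset)
  have hBE := hB'.subset_ground
  rw [hx.delete_isBase_iff] at hB'
  refine ⟨_, hB'.1, ?_⟩
  have aux : ∀ B : Set α, B ⊆ M.E \ {x} → B ∩ (X ∩ (M.E \ {x})) = B ∩ X := fun B hB => by
    rw [inter_comm X, ← inter_assoc, inter_eq_left.2 hB]
  rwa [aux B hB, aux B' hBE] at hle

lemma coindep_singleton {x : α} (hxE : x ∈ M.E) (hx : ¬ M.IsColoop x) : M.Coindep {x} := by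
  rw [Matroid.coindep_def, Matroid.indep_singleton]
  refine ⟨?_, hxE⟩
  rwa [Matroid.dual_isLoop_iff_isColoop]

lemma contractElem_eq_deleteElem_of_isColoop {x : α} (hx : M.IsColoop x) : M ／ {x} = M ＼ {x} :=
  Matroid.contract_eq_delete_of_subset_coloops (singleton_subset_iff.2 hx)

/-- Contracting a loop is deleting it, and a loop is not a coloop, so the deletion lemma for
coindependent elements applies. -/
lemma IsIntervalDetermined.contractElem [M.Finite] (hM : IsIntervalDetermined M) (x : α) :
    IsIntervalDetermined (M ／ {x}) := by
  by_cases hxE : x ∈ M.E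
  · by_cases hl : M.IsLoop x
    · rw [Matroid.contract_eq_delete_of_subset_loops (singleton_subset_iff.2 hl)]
      exact hM.deleteElem_of_not_isColoop (coindep_singleton hxE hl.not_isColoop)
    · exact hM.contractElem_of_isNonloop ⟨hl, hxE⟩
  · rwa [Matroid.contractElem_eq_self hxE]

lemma IsIntervalDetermined.deleteElem [M.Finite] (hM : IsIntervalDetermined M) (x : α) :
    IsIntervalDetermined (M ＼ {x}) := by
  by_cases hxE : x ∈ M.E
  · by_cases hl : M.IsColoop x
    · rw [← contractElem_eq_deleteElem_of_isColoop hl]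
      exact hM.contractElem x
    · exact hM.deleteElem_of_not_isColoop (coindep_singleton hxE hl)
  · rwa [Matroid.deleteElem_eq_self hxE]

lemma IsIntervalDetermined.contract [M.Finite] (hM : IsIntervalDetermined M) {C : Set α}
    (hC : C.Finite) : IsIntervalDetermined (M ／ C) := by
  induction C, hC using Set.Finite.induction_on with
  | empty => simpa using hM
  | @insert a s _ _ ih =>
    rw [insert_eq, union_comm, ← Matroid.contract_contract]
    exact ih.contractElem a

lemma IsIntervalDetermined.delete [M.Finite] (hM : IsIntervalDetermined M) {D : Set α}
    (hD : D.Finite) : IsIntervalDetermined (M ＼ D) := by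
  induction D, hD using Set.Finite.induction_on with
  | empty => simpa using hM
  | @insert a s _ _ ih =>
    rw [insert_eq, union_comm, ← Matroid.delete_delete]
    exact ih.deleteElem a

/-- It suffices to check the one-element minors, as the class is closed under minors. -/
lemma isIntervalPositroid_of_isStrictMinor [M.Finite]
    (hd : ∀ x ∈ M.E, IsIntervalDetermined (M ＼ {x}))
    (hc : ∀ x ∈ M.E, IsIntervalDetermined (M ／ {x})) (hN : N <m M) : IsIntervalPositroid N := by
  obtain ⟨C, D, hC, hD, hCD, rfl⟩ := hN.isMinor.exists_eq_contract_delete_disjoint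
  have hCf := M.ground_finite.subset hC
  have hDf := M.ground_finite.subset hD
  apply IsIntervalDetermined.isIntervalPositroid
  rcases C.eq_empty_or_nonempty with rfl | ⟨x, hx⟩
  · rcases D.eq_empty_or_nonempty with rfl | ⟨x, hx⟩
    · rw [Matroid.contract_empty, Matroid.delete_empty] at hN
      exact absurd hN (Matroid.isStrictMinor_irrefl M)
    · rw [Matroid.contract_empty, ← insert_sdiff_self_of_mem hx, insert_eq, ← Matroid.delete_delete]
      exact (hd x (hD hx)).delete hDf.sdiff
  · rw [← insert_sdiff_self_of_mem hx, insert_eq, ← Matroid.contract_contract]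
    exact ((hc x (hC hx)).contract hCf.sdiff).delete hDf

/-- An element between two elements `y`, `z` of a non-basis `S` cannot be exchanged for both. -/
lemma IsIntervalDetermined.exists_order [N.Finite] (hN : IsIntervalDetermined N) :
    ∃ p : α → ℤ, InjOn p N.E ∧ ∀ S ⊆ N.E, ∀ y ∈ S, ∀ z ∈ S, ∀ e, e ∉ S → p y ≤ p e → p e ≤ p z →
      N.IsBase (insert e (S \ {y})) → N.IsBase (insert e (S \ {z})) → N.IsBase S := by
  obtain ⟨p, hp, h⟩ := hN
  refine ⟨p, hp, fun S hS y hy z hz e he hye hez hb1 hb2 => h S hS ?_ fun X hX => ?_⟩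
  · rw [← hb1.encard_eq_eRank, encard_insert_of_notMem (fun h => he h.1),
      encard_sdiff_singleton_add_one hy]
  have hSf := N.ground_finite.subset hS
  -- If an interval misses y or z, trading that element for e does not lower the count on it. If it
  -- contains both, it contains e, and the trade keeps the count.
  have key : ∀ w ∈ S, w ∉ X → S ∩ X ⊆ insert e (S \ {w}) ∩ X := by
    rintro w - hwX u ⟨hu, huX⟩
    exact ⟨Or.inr ⟨hu, fun huw => hwX (huw ▸ huX)⟩, huX⟩
  by_cases hyX : y ∈ X
  · by_cases hzX : z ∈ X
    · have heE : e ∈ N.E := hb1.subset_ground (mem_insert _ _)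
      have heX : e ∈ X := hX.2 y hyX z hzX e heE hye hez
      refine ⟨_, hb1, ?_⟩
      rw [insert_inter_of_mem heX, ncard_insert_of_notMem (fun h => he h.1.1)
        (hSf.sdiff.inter_of_left _), ← inter_sdiff_right_comm,
        ncard_sdiff_singleton_add_one (mem_inter hy hyX) (hSf.inter_of_left _)]
    · exact ⟨_, hb2, ncard_le_ncard (key z hz hzX) ((hSf.sdiff.insert _).inter_of_left _)⟩
  · exact ⟨_, hb1, ncard_le_ncard (key y hy hyX) ((hSf.sdiff.insert _).inter_of_left _)⟩

/-- If every dependent set of the size of a basis lies in an interval that contains no basis, then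
the matroid is determined by the ranks of intervals. -/
lemma isIntervalDetermined_of_forall_exists [N.Finite] (p : α → ℤ) (hp : InjOn p N.E)
    (h : ∀ B ⊆ N.E, B.encard = N.eRank → ¬ N.IsBase B →
      ∃ X, IsConvexIn p N.E X ∧ B ⊆ X ∧ ∀ B', N.IsBase B' → ¬ B' ⊆ X) :
    IsIntervalDetermined N := by
  refine ⟨p, hp, fun B hB hBc hX => ?_⟩
  by_contra hnb
  obtain ⟨X, hXc, hBX, hb⟩ := h B hB hBc hnb
  obtain ⟨B', hB', hle⟩ := hX X hXc
  refine hb B' hB' ?_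
  rw [inter_eq_left.2 hBX] at hle
  have hB'f := N.ground_finite.subset hB'.subset_ground
  have hcard : B.ncard = B'.ncard := by rw [ncard, ncard, hBc, hB'.encard_eq_eRank]
  have := eq_of_subset_of_ncard_le (inter_subset_left : B' ∩ X ⊆ B') (by omega) hB'f
  rw [← this]
  exact inter_subset_right

end Minors

/-! ### Paving matroids through their edges -/

section Paving

open scoped Matroid

variable {α : Type*} {M : Matroid α} {d : ℕ} {H H' S : Set α} {e x : α}

/-- The combinatorial properties of the edges of a paving matroid of rank `d` on `E`. -/
structure IsPavingSystem (d : ℕ) (E : Set α) (𝓔 : Set (Set α)) : Prop where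
  finite : E.Finite
  subset : ∀ H ∈ 𝓔, H ⊆ E
  card : ∀ H ∈ 𝓔, d ≤ H.ncard
  inter : ∀ H ∈ 𝓔, ∀ H' ∈ 𝓔, H ≠ H' → (H ∩ H').ncard + 2 ≤ d
  ne : ∀ H ∈ 𝓔, H ≠ E

lemma indep_of_ncard_lt [M.Finite] (hrank : M.eRank = d) (hp : IsPaving M) (hS : S ⊆ M.E)
    (h : S.ncard < d) : M.Indep S := by
  by_contra hni
  obtain ⟨K, hKS, hK⟩ := ((Matroid.not_indep_iff hS).1 hni).exists_isCircuit_subset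
  have h1 := (hp K hK).trans (encard_le_encard hKS)
  rw [hrank, ← (M.ground_finite.subset hS).cast_ncard_eq] at h1
  have : d ≤ S.ncard := by exact_mod_cast h1
  omega

lemma isBase_of_indep_of_ncard [M.Finite] (hrank : M.eRank = d) (hS : M.Indep S)
    (h : S.ncard = d) : M.IsBase S := by
  have hf := M.ground_finite.subset hS.subset_ground
  refine hS.isBase_of_eRk_ge hf ?_
  rw [hS.eRk_eq_encard, hrank, ← hf.cast_ncard_eq, h]

lemma not_indep_of_subset_hyperplane [M.Finite] (hrank : M.eRank = d)
    (hH : H ∈ dependentHyperplanes M) (hS : S ⊆ H) (h : S.ncard = d) : ¬ M.Indep S := by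
  intro hi
  have h1 := hi.encard_le_eRk_of_subset hS
  have hf := M.ground_finite.subset hi.subset_ground
  rw [← hf.cast_ncard_eq, h] at h1
  have h2 := hH.1.2
  rw [hrank] at h2
  have h3 : (d : ℕ∞) + 1 ≤ d := by
    calc (d : ℕ∞) + 1 ≤ M.eRk H + 1 := by gcongr
      _ = d := h2
  have : d + 1 ≤ d := by exact_mod_cast h3
  omega

lemma isBase_insert_of_notMem_hyperplane [M.Finite] (hrank : M.eRank = d) (hp : IsPaving M)
    (hH : H ∈ dependentHyperplanes M) (hS : S ⊆ H) (h : S.ncard + 1 = d) (he : e ∈ M.E)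
    (heH : e ∉ H) : M.IsBase (insert e S) := by
  have hSE := hS.trans hH.1.1.subset_ground
  have hi := indep_of_ncard_lt hrank hp hSE (by omega)
  have hcl : M.closure S ⊆ H := by
    rw [← hH.1.1.closure]; exact M.closure_subset_closure hS
  refine isBase_of_indep_of_ncard hrank ?_ ?_
  · rw [hi.insert_indep_iff]
    exact Or.inl ⟨he, fun hc => heH (hcl hc)⟩
  · rw [ncard_insert_of_notMem (fun hc => heH (hS hc)) (M.ground_finite.subset hSE), h]

/-- A dependent set of d elements in a paving matroid is itself a circuit, so its closure has rank d
- 1. -/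
lemma exists_hyperplane_of_not_indep [M.Finite] (hrank : M.eRank = d) (hp : IsPaving M)
    (hS : S ⊆ M.E) (h : S.ncard = d) (hni : ¬ M.Indep S) :
    ∃ H ∈ dependentHyperplanes M, S ⊆ H := by
  have hdep := (Matroid.not_indep_iff hS).1 hni
  have hf := M.ground_finite.subset hS
  obtain ⟨K, hKS, hK⟩ := hdep.exists_isCircuit_subset
  have h1 := hp K hK
  have hKS' : K = S := by
    refine eq_of_subset_of_ncard_le hKS ?_ hf
    rw [hrank, ← (hf.subset hKS).cast_ncard_eq] at h1
    rw [h]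
    exact_mod_cast h1
  subst hKS'
  refine ⟨M.closure K, ⟨⟨M.isFlat_closure K, ?_⟩, ?_⟩, M.subset_closure K⟩
  · rw [M.eRk_closure_eq, hK.eRk_add_one_eq, hrank, ← hf.cast_ncard_eq, h]
  · exact hdep.superset (M.subset_closure K) (M.closure_subset_ground K)

/-- If two edges shared d - 1 points, adding a point of one that is outside the other would give a
basis inside an edge. -/
lemma isPavingSystem_dependentHyperplanes [M.Finite] (hrank : M.eRank = d) (hp : IsPaving M)
    (hd : 1 ≤ d) : IsPavingSystem d M.E (dependentHyperplanes M) := by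
  have hsub : ∀ H ∈ dependentHyperplanes M, H ⊆ M.E := fun H hH => hH.1.1.subset_ground
  have hf : ∀ H ∈ dependentHyperplanes M, H.Finite := fun H hH => M.ground_finite.subset (hsub H hH)
  have key : ∀ H ∈ dependentHyperplanes M, ∀ H' ∈ dependentHyperplanes M, d ≤ (H ∩ H').ncard + 1 →
      H' ⊆ H := by
    intro H hH H' hH' hc e he'
    by_contra he
    obtain ⟨S, hS, hSc⟩ := exists_subset_card_eq (show d - 1 ≤ (H ∩ H').ncard by omega)
    have hb := isBase_insert_of_notMem_hyperplane hrank hp hH (hS.trans inter_subset_left)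
      (by omega) (hsub _ hH' he') he
    refine not_indep_of_subset_hyperplane hrank hH'
      (insert_subset he' (hS.trans inter_subset_right)) ?_ hb.indep
    rw [ncard_insert_of_notMem (fun h => he (hS h).1) (((hf H hH).inter_of_left _).subset hS)]
    omega
  refine ⟨M.ground_finite, hsub, fun H hH => ?_, fun H hH H' hH' hne => ?_, ?_⟩
  · by_contra hlt
    exact hH.2.not_indep (indep_of_ncard_lt hrank hp (hsub H hH) (by omega))
  · by_contra hlt
    exact hne (Subset.antisymm (key H' hH' H hH (by rw [inter_comm]; omega))
      (key H hH H' hH' (by omega)))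
  · rintro H hH rfl
    have := hH.1.2
    rw [M.eRk_ground, hrank] at this
    have : d + 1 = d := by exact_mod_cast this
    omega

lemma ncard_pair_le_two (y z : α) : ({y, z} : Set α).ncard ≤ 2 :=
  (ncard_insert_le y {z}).trans (by rw [ncard_singleton])

/-- The edges of a deletion that is an interval positroid are intervals. -/
lemma exists_order_of_delete [M.Finite] (hrank : M.eRank = d) (hp : IsPaving M) (hd : 2 ≤ d)
    {D : Set α} (h : IsIntervalDetermined (M ＼ D)) : ∃ p : α → ℤ, InjOn p (M.E \ D) ∧
      ∀ H ∈ dependentHyperplanes M, d ≤ (H \ D).ncard → IsConvexIn p (M.E \ D) (H \ D) := by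
  obtain ⟨p, hpi, h⟩ := h.exists_order
  refine ⟨p, hpi, fun H hH hc => ⟨sdiff_subset_sdiff_left hH.1.1.subset_ground,
    fun y hy z hz e he hye hez => ?_⟩⟩
  have hHE := hH.1.1.subset_ground
  have hHf := M.ground_finite.subset hHE
  by_contra heH
  have heH : e ∉ H := fun h => heH ⟨h, he.2⟩
  -- A point e strictly outside H but between y and z turns every d-subset S of H through y and z
  -- into a basis by one exchange; `exists_order` then makes S itself a basis.
  obtain ⟨S, hSs, hSH, hSc⟩ := exists_subsuperset_card_eq
    (show {y, z} ⊆ H \ D from pair_subset hy hz) (ncard_pair_le_two y z |>.trans hd) hc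
  have hSf := hHf.sdiff.subset hSH
  have hb : ∀ w ∈ S, (M ＼ D).IsBase (insert e (S \ {w})) := by
    intro w hw
    have hb := isBase_insert_of_notMem_hyperplane hrank hp hH
      (sdiff_subset.trans (hSH.trans sdiff_subset) : S \ {w} ⊆ H)
      (by rw [ncard_sdiff_singleton_add_one hw hSf, hSc]) he.1 heH
    rw [Matroid.delete_isBase_iff]
    exact hb.isBasis_ground.isBasis_subset
      (insert_subset he (sdiff_subset.trans (hSH.trans (sdiff_subset_sdiff_left hHE)))) sdiff_subset
  have hyS : y ∈ S := hSs (by simp)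
  have hzS : z ∈ S := hSs (by simp)
  have := h S (hSH.trans (sdiff_subset_sdiff_left hHE)) y hyS z hzS e (fun h => heH (hSH h).1)
    hye hez (hb y hyS) (hb z hzS)
  exact not_indep_of_subset_hyperplane hrank hH (hSH.trans sdiff_subset) hSc
    this.indep.of_delete

/-- The edges of a contraction that is an interval positroid are intervals. -/
lemma exists_order_of_contract [M.Finite] (hrank : M.eRank = d) (hp : IsPaving M) (hd : 3 ≤ d)
    (hx : x ∈ M.E) (h : IsIntervalDetermined (M ／ {x})) :
    ∃ p : α → ℤ, InjOn p (M.E \ {x}) ∧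
      ∀ H ∈ dependentHyperplanes M, x ∈ H → IsConvexIn p (M.E \ {x}) (H \ {x}) := by
  obtain ⟨p, hpi, h⟩ := h.exists_order
  have hxi : M.Indep {x} := indep_of_ncard_lt hrank hp (by simpa using hx)
    (by rw [ncard_singleton]; omega)
  refine ⟨p, hpi, fun H hH hxH => ⟨sdiff_subset_sdiff_left hH.1.1.subset_ground,
    fun y hy z hz e he hye hez => ?_⟩⟩
  have hHE := hH.1.1.subset_ground
  have hHf := M.ground_finite.subset hHE
  by_contra heH
  have heH : e ∉ H := fun h => heH ⟨h, he.2⟩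
  have hHc := (isPavingSystem_dependentHyperplanes hrank hp (by omega)).card H hH
  obtain ⟨S, hSs, hSH, hSc⟩ := exists_subsuperset_card_eq (n := d - 1)
    (show {y, z} ⊆ H \ {x} from pair_subset hy hz) ((ncard_pair_le_two y z).trans (by omega))
    (by have := ncard_sdiff_singleton_add_one hxH hHf; omega)
  have hSf := hHf.sdiff.subset hSH
  have hxS : x ∉ S := fun h => (hSH h).2 rfl
  have hb : ∀ w ∈ S, (M ／ {x}).IsBase (insert e (S \ {w})) := by
    intro w hw
    have hb := isBase_insert_of_notMem_hyperplane hrank hp hH (S := insert x (S \ {w}))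
      (insert_subset hxH (sdiff_subset.trans (hSH.trans sdiff_subset)))
      (by
        have := ncard_sdiff_singleton_add_one hw hSf
        rw [ncard_insert_of_notMem (fun h => hxS h.1) hSf.sdiff]; omega) he.1 heH
    rw [hxi.contract_isBase_iff, union_singleton, insert_comm]
    refine ⟨hb, disjoint_singleton_right.2 ?_⟩
    rintro (h | h)
    · exact he.2 h.symm
    · exact hxS h.1
  have hyS : y ∈ S := hSs (by simp)
  have hzS : z ∈ S := hSs (by simp)
  have := h S (hSH.trans (sdiff_subset_sdiff_left hHE)) y hyS z hzS e (fun h => heH (hSH h).1)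
    hye hez (hb y hyS) (hb z hzS)
  rw [hxi.contract_isBase_iff, union_singleton] at this
  refine not_indep_of_subset_hyperplane hrank hH (insert_subset hxH (hSH.trans sdiff_subset)) ?_
    this.1.indep
  rw [ncard_insert_of_notMem hxS hSf]
  omega

/-- A non-basis `B` of the right size, with `x` added, lies in some edge H. Then H \ {x} is an
interval containing `B` and no basis of the contraction. -/
lemma isIntervalDetermined_contractElem [M.Finite] (hrank : M.eRank = d) (hp : IsPaving M)
    (hd : 2 ≤ d) (hx : x ∈ M.E) (p : α → ℤ) (hpi : InjOn p (M.E \ {x}))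
    (h : ∀ H ∈ dependentHyperplanes M, x ∈ H → IsConvexIn p (M.E \ {x}) (H \ {x})) :
    IsIntervalDetermined (M ／ {x}) := by
  have hxi : M.Indep {x} := indep_of_ncard_lt hrank hp (by simpa using hx)
    (by rw [ncard_singleton]; omega)
  have hbc : ∀ B, (M ／ {x}).IsBase B → (insert x B).ncard = d := by
    intro B hB
    rw [hxi.contract_isBase_iff, union_singleton] at hB
    rw [ncard, hB.1.encard_eq_eRank, hrank]
    rfl
  refine isIntervalDetermined_of_forall_exists p hpi fun B hB hBc hnb => ?_
  have hBx : x ∉ B := fun h => (hB h).2 rfl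
  have hBE := hB.trans sdiff_subset
  have hBf := M.ground_finite.subset hBE
  obtain ⟨B₀, hB₀⟩ := (M ／ {x}).exists_isBase
  have hcard : (insert x B).ncard = d := by
    rw [← hbc B₀ hB₀, ncard, ncard, encard_insert_of_notMem hBx, hBc, ← hB₀.encard_eq_eRank,
      encard_insert_of_notMem fun h => (hB₀.subset_ground h).2 rfl]
  rw [hxi.contract_isBase_iff, union_singleton, not_and_or] at hnb
  replace hnb := hnb.resolve_right (not_not.2 (disjoint_singleton_right.2 hBx))
  obtain ⟨H, hH, hBH⟩ := exists_hyperplane_of_not_indep hrank hp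
    (insert_subset hx hBE) hcard fun hi => hnb (isBase_of_indep_of_ncard hrank hi hcard)
  have hxH := hBH (mem_insert _ _)
  refine ⟨_, h H hH hxH, fun b hb => ⟨hBH (Or.inr hb), fun h => hBx (h ▸ hb)⟩, fun B' hB' hs => ?_⟩
  have hc := hbc B' hB'
  rw [hxi.contract_isBase_iff, union_singleton] at hB'
  exact not_indep_of_subset_hyperplane hrank hH (insert_subset hxH (hs.trans sdiff_subset)) hc
    hB'.1.indep

/-- Coindependence keeps the rank at d, so only edges with at least d remaining points can contain a
dependent set of basis size. -/
lemma isIntervalDetermined_deleteElem [M.Finite] (hrank : M.eRank = d) (hp : IsPaving M)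
    (hx : M.Coindep {x}) (p : α → ℤ) (hpi : InjOn p (M.E \ {x}))
    (h : ∀ H ∈ dependentHyperplanes M, d ≤ (H \ {x}).ncard → IsConvexIn p (M.E \ {x}) (H \ {x})) :
    IsIntervalDetermined (M ＼ {x}) := by
  have hbc : ∀ B, (M ＼ {x}).IsBase B → B.ncard = d := by
    intro B hB
    rw [hx.delete_isBase_iff] at hB
    rw [ncard, hB.1.encard_eq_eRank, hrank]
    rfl
  refine isIntervalDetermined_of_forall_exists p hpi fun B hB hBc hnb => ?_
  have hBE := hB.trans sdiff_subset
  have hBf := M.ground_finite.subset hBE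
  obtain ⟨B₀, hB₀⟩ := (M ＼ {x}).exists_isBase
  have hcard : B.ncard = d := by
    rw [← hbc B₀ hB₀, ncard, ncard, hBc, ← hB₀.encard_eq_eRank]
  have hBx : Disjoint B {x} := (subset_sdiff.1 hB).2
  rw [hx.delete_isBase_iff, not_and_or] at hnb
  replace hnb := hnb.resolve_right (not_not.2 hBx)
  obtain ⟨H, hH, hBH⟩ := exists_hyperplane_of_not_indep hrank hp
    hBE hcard fun hi => hnb (isBase_of_indep_of_ncard hrank hi hcard)
  have hBH' : B ⊆ H \ {x} := subset_sdiff.2 ⟨hBH, hBx⟩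
  have hHf := M.ground_finite.subset hH.1.1.subset_ground
  refine ⟨_, h H hH (by rw [← hcard]; exact ncard_le_ncard hBH' hHf.sdiff), hBH',
    fun B' hB' hs => ?_⟩
  have hc := hbc B' hB'
  rw [hx.delete_isBase_iff] at hB'
  exact not_indep_of_subset_hyperplane hrank hH (hs.trans sdiff_subset) hc hB'.1.indep

/-- A system of edges with the properties of a paving system comes from a paving matroid. -/
lemma IsPavingSystem.isPavingClutter {E : Set α} {𝓔 : Set (Set α)} (h : IsPavingSystem d E 𝓔)
    (hd : 2 ≤ d) (hne : 𝓔.Nonempty) : IsPavingClutter d E 𝓔 := by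
  have hf : ∀ H ∈ 𝓔, H.Finite := fun H hH => h.finite.subset (h.subset H hH)
  -- A set of d - 1 points lies in at most one edge; exchange and closure below both rest on this.
  have huniq : ∀ S : Set α, S.ncard + 1 = d → ∀ H ∈ 𝓔, ∀ H' ∈ 𝓔, S ⊆ H → S ⊆ H' → H = H' := by
    intro S hS H hH H' hH' h1 h2
    by_contra hne
    have := h.inter H hH H' hH' hne
    have := ncard_le_ncard (subset_inter h1 h2) ((hf H hH).inter_of_left _)
    omega
  have hext : ∀ S ⊆ E, S.ncard + 1 = d → ∃ e ∈ E, e ∉ S ∧ ∀ H ∈ 𝓔, ¬ insert e S ⊆ H := by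
    intro S hS hSc
    by_cases hex : ∃ H ∈ 𝓔, S ⊆ H
    · obtain ⟨H, hH, hSH⟩ := hex
      obtain ⟨e, heE, heH⟩ := exists_of_ssubset ((h.subset H hH).ssubset_of_ne (h.ne H hH))
      refine ⟨e, heE, fun he => heH (hSH he), fun H' hH' hs => heH ?_⟩
      rw [huniq S hSc H hH H' hH' hSH ((subset_insert _ _).trans hs)]
      exact hs (mem_insert _ _)
    · push Not at hex
      obtain ⟨H, hH⟩ := hne
      obtain ⟨e, heH, heS⟩ := not_subset.1 fun hs : H ⊆ S => by
        have := ncard_le_ncard hs (h.finite.subset hS)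
        have := h.card H hH
        omega
      exact ⟨e, h.subset H hH heH, heS, fun H' hH' hs =>
        hex H' hH' ((subset_insert _ _).trans hs)⟩
  have hEc : d ≤ E.ncard := by
    obtain ⟨H, hH⟩ := hne
    exact (h.card H hH).trans (ncard_le_ncard (h.subset H hH) h.finite)
  -- The bases are the d-sets contained in no edge.
  set P : Set α → Prop := fun B => B ⊆ E ∧ B.ncard = d ∧ ∀ H ∈ 𝓔, ¬ B ⊆ H with hP
  have hsmall : ∀ S ⊆ E, S.ncard < d → ∃ B, P B ∧ S ⊆ B := by
    intro S hS hSc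
    obtain ⟨T, hST, hTE, hTc⟩ := exists_subsuperset_card_eq (n := d - 1) hS (by omega) (by omega)
    obtain ⟨e, he, heT, hex⟩ := hext T hTE (by omega)
    exact ⟨insert e T, ⟨insert_subset he hTE, by
      rw [ncard_insert_of_notMem heT (h.finite.subset hTE)]; omega, hex⟩,
      hST.trans (subset_insert _ _)⟩
  -- If no b in Y \ X could replace a, every X - a + b would lie in an edge; by uniqueness these
  -- edges coincide, and that edge would contain Y.
  have hexch : Matroid.ExchangeProperty P := by
    rintro X Y ⟨hXE, hXc, hX⟩ ⟨hYE, hYc, hY⟩ a ⟨haX, haY⟩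
    by_contra hcon
    push Not at hcon
    have hXf := h.finite.subset hXE
    have hXa : (X \ {a}).ncard + 1 = d := by rw [ncard_sdiff_singleton_add_one haX hXf, hXc]
    have hH : ∀ b ∈ Y \ X, ∃ H ∈ 𝓔, insert b (X \ {a}) ⊆ H := by
      intro b hb
      by_contra hno
      push Not at hno
      refine hcon b hb ⟨insert_subset (hYE hb.1) (sdiff_subset.trans hXE), ?_, hno⟩
      rw [ncard_insert_of_notMem (fun h => hb.2 h.1) hXf.sdiff, hXa]
    obtain ⟨b, hbY, hbX⟩ := not_subset.1 fun hs : Y ⊆ X => haY (by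
      rw [eq_of_subset_of_ncard_le hs (by omega) hXf]; exact haX)
    obtain ⟨H, hHm, hs⟩ := hH b ⟨hbY, hbX⟩
    refine hY H hHm fun y hy => ?_
    by_cases hyX : y ∈ X
    · exact hs (Or.inr ⟨hyX, fun hya => haY (hya ▸ hy)⟩)
    · obtain ⟨H', hHm', hs'⟩ := hH y ⟨hy, hyX⟩
      rw [huniq _ hXa H hHm H' hHm' ((subset_insert _ _).trans hs) ((subset_insert _ _).trans hs')]
      exact hs' (mem_insert _ _)
  set N := Matroid.ofIsBaseOfFinite h.finite P
    (by obtain ⟨B, hB, -⟩ := hsmall ∅ (empty_subset _) (by simp; omega); exact ⟨B, hB⟩)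
    hexch (fun B hB => hB.1) with hN
  have hNb : ∀ B, N.IsBase B ↔ P B := fun B => Iff.rfl
  have hNE : N.E = E := rfl
  have hNfin : N.Finite := ⟨h.finite⟩
  have hNr : N.eRank = d := by
    obtain ⟨B, hB⟩ := N.exists_isBase
    rw [← hB.encard_eq_eRank, ← (h.finite.subset hB.subset_ground).cast_ncard_eq, hB.2.1]
  have hNp : IsPaving N := by
    intro K hK
    have hKf := h.finite.subset hK.subset_ground
    rw [hNr, ← hKf.cast_ncard_eq]
    by_contra hlt
    have hlt : K.ncard < d := by
      have := not_le.1 hlt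
      exact_mod_cast this
    obtain ⟨B, hB, hKB⟩ := hsmall K hK.subset_ground hlt
    exact hK.dep.not_indep (((hNb B).2 hB).indep.subset hKB)
  have hdep : ∀ H ∈ 𝓔, ∀ S ⊆ H, S.ncard = d → ¬ N.Indep S := fun H hH S hS hSc hi =>
    ((hNb S).1 (isBase_of_indep_of_ncard hNr hi hSc)).2.2 H hH hS
  have hcl : ∀ H ∈ 𝓔, ∀ S ⊆ H, S.ncard + 1 = d → N.closure S = H := by
    intro H hH S hS hSc
    have hSf := (hf H hH).subset hS
    have hSi : N.Indep S := indep_of_ncard_lt hNr hNp (hS.trans (h.subset H hH)) (by omega)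
    ext e
    rw [hSi.mem_closure_iff']
    constructor
    · rintro ⟨he, hi⟩
      by_contra heH
      have heS : e ∉ S := fun h => heH (hS h)
      refine heS (hi ?_)
      refine ((hNb (insert e S)).2 ⟨insert_subset he (hS.trans (h.subset H hH)), ?_, ?_⟩).indep
      · rw [ncard_insert_of_notMem heS hSf, hSc]
      · intro H' hH' hs
        apply heH
        rw [huniq S hSc H hH H' hH' hS ((subset_insert _ _).trans hs)]
        exact hs (mem_insert _ _)
    · intro heH
      refine ⟨h.subset H hH heH, fun hi => ?_⟩
      by_contra heS
      exact hdep H hH _ (insert_subset heH hS) (by rw [ncard_insert_of_notMem heS hSf, hSc]) hi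
  refine ⟨hd, N, hNfin, hNE, hNr, hNp, ?_⟩
  ext G
  constructor
  · intro hG
    have hGs := isPavingSystem_dependentHyperplanes hNr hNp (by omega)
    obtain ⟨S, hSG, hSc⟩ := exists_subset_card_eq (hGs.card G hG)
    have hSE : S ⊆ E := hSG.trans hG.1.1.subset_ground
    have : ¬ P S := fun hS => not_indep_of_subset_hyperplane hNr hG hSG hSc
      ((hNb S).2 hS).indep
    obtain ⟨H, hH, hSH⟩ : ∃ H ∈ 𝓔, S ⊆ H := by
      by_contra hno
      push Not at hno
      exact this ⟨hSE, hSc, hno⟩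
    -- The edges G and H are both the closure of any d - 1 of their common points.
    obtain ⟨T, hTS, hTc⟩ := exists_subset_card_eq (show d - 1 ≤ S.ncard by omega)
    suffices G = H by rwa [this]
    rw [← hcl H hH T (hTS.trans hSH) (by omega)]
    refine Subset.antisymm (fun e he => ?_) ?_
    · by_contra hecl
      have hTi : N.Indep T := indep_of_ncard_lt hNr hNp (hTS.trans hSE) (by omega)
      have heT : e ∉ T := fun h => hecl (N.mem_closure_of_mem h (hTS.trans hSE))
      refine not_indep_of_subset_hyperplane hNr hG (insert_subset he (hTS.trans hSG)) ?_
        ((hTi.insert_indep_iff).2 (Or.inl ⟨hG.1.1.subset_ground he, hecl⟩))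
      rw [ncard_insert_of_notMem heT (h.finite.subset (hTS.trans hSE))]
      omega
    · conv_rhs => rw [← hG.1.1.closure]
      exact N.closure_subset_closure (hTS.trans hSG)
  · intro hH
    have hHc := h.card G hH
    obtain ⟨S, hSH, hSc⟩ := exists_subset_card_eq (show d - 1 ≤ G.ncard by omega)
    obtain ⟨T, hTH, hTc⟩ := exists_subset_card_eq hHc
    have hSf := (hf G hH).subset hSH
    have hSi : N.Indep S := indep_of_ncard_lt hNr hNp (hSH.trans (h.subset G hH)) (by omega)
    have hcl' := hcl G hH S hSH (by omega)
    refine ⟨⟨?_, ?_⟩, ?_⟩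
    · rw [← hcl']; exact N.isFlat_closure S
    · rw [← hcl', N.eRk_closure_eq, hSi.eRk_eq_encard, hNr, ← hSf.cast_ncard_eq, hSc]
      have : d - 1 + 1 = d := by omega
      exact_mod_cast this
    · exact ((Matroid.not_indep_iff (hTH.trans (h.subset G hH))).1
        (hdep G hH T hTH hTc)).superset hTH (h.subset G hH)

end Paving

/-! ### Intervals of a linear order -/

section Intervals

variable {α : Type*} {p : α → ℤ} {E : Set α}

lemma IsConvexIn.neg {X : Set α} (hX : IsConvexIn p E X) : IsConvexIn (-p) E X :=
  ⟨hX.1, fun x hx y hy z hz h1 h2 => hX.2 y hy x hx z hz (neg_le_neg_iff.1 h2)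
    (neg_le_neg_iff.1 h1)⟩

/-- Three intervals with a common point do not all have private points. -/
lemma false_of_three_private {A B C : Set α} (hA : IsConvexIn p E A) (hB : IsConvexIn p E B)
    (hC : IsConvexIn p E C) {v a b c : α} (hvA : v ∈ A) (hvB : v ∈ B) (hvC : v ∈ C)
    (ha : a ∈ A) (haB : a ∉ B) (haC : a ∉ C) (hb : b ∈ B) (hbA : b ∉ A) (hbC : b ∉ C)
    (hc : c ∈ C) (hcA : c ∉ A) (hcB : c ∉ B) : False := by
  -- Points of X \ Y and Y \ X lie strictly on opposite sides of v; three points cannot do so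
  -- pairwise.
  have key : ∀ {X Y : Set α}, IsConvexIn p E X → IsConvexIn p E Y → v ∈ X → v ∈ Y →
      ∀ x ∈ X, x ∉ Y → ∀ y ∈ Y, y ∉ X →
      (p x < p v ∧ p v < p y) ∨ (p y < p v ∧ p v < p x) := by
    intro X Y hX hY hvX hvY x hx hxY y hy hyX
    have h1 := hX.2 v hvX x hx y (hY.1 hy)
    have h2 := hX.2 x hx v hvX y (hY.1 hy)
    have h3 := hY.2 v hvY y hy x (hX.1 hx)
    have h4 := hY.2 y hy v hvY x (hX.1 hx)
    by_contra hcon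
    rcases le_total (p x) (p v) with h | h <;> rcases le_total (p y) (p v) with h' | h' <;>
      rcases le_total (p x) (p y) with h'' | h'' <;> grind
  have h1 := key hA hB hvA hvB a ha haB b hb hbA
  have h2 := key hA hC hvA hvC a ha haC c hc hcA
  have h3 := key hB hC hvB hvC b hb hbC c hc hcB
  omega

/-- An interval meeting both differences of two intersecting intervals contains their
intersection. -/
lemma mem_of_mem_sdiff_of_mem_sdiff {P Q D : Set α} (hP : IsConvexIn p E P)
    (hQ : IsConvexIn p E Q) (hD : IsConvexIn p E D) {v u w : α} (hvP : v ∈ P) (hvQ : v ∈ Q)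
    (huD : u ∈ D) (huP : u ∈ P) (huQ : u ∉ Q) (hwD : w ∈ D) (hwQ : w ∈ Q) (hwP : w ∉ P) :
    v ∈ D := by
  -- These betweenness facts place u and w on opposite sides of v, so an interval through both
  -- contains v.
  have h1 := hP.2 v hvP u huP w (hQ.1 hwQ)
  have h2 := hP.2 u huP v hvP w (hQ.1 hwQ)
  have h3 := hQ.2 v hvQ w hwQ u (hP.1 huP)
  have h4 := hQ.2 w hwQ v hvQ u (hP.1 huP)
  have h5 := hD.2 u huD w hwD v (hP.1 hvP)
  have h6 := hD.2 w hwD u huD v (hP.1 hvP)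
  rcases le_total (p u) (p v) with h | h <;> rcases le_total (p w) (p v) with h' | h' <;>
    rcases le_total (p u) (p w) with h'' | h'' <;> grind

/-- Disjoint nonempty intervals are comparable. -/
lemma IsConvexIn.lt_or_gt {X Y : Set α} (hX : IsConvexIn p E X) (hY : IsConvexIn p E Y)
    (hd : ∀ x ∈ X, x ∉ Y) {x₀ y₀ : α} (hx₀ : x₀ ∈ X) (hy₀ : y₀ ∈ Y) :
    (∀ x ∈ X, ∀ y ∈ Y, p x < p y) ∨ (∀ x ∈ X, ∀ y ∈ Y, p y < p x) := by
  have key : ∀ {X Y : Set α}, IsConvexIn p E X → IsConvexIn p E Y → (∀ x ∈ X, x ∉ Y) →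
      ∀ x₀ ∈ X, ∀ y₀ ∈ Y, p x₀ ≤ p y₀ → ∀ x ∈ X, ∀ y ∈ Y, p x < p y := by
    intro X Y hX hY hd x₀ hx₀ y₀ hy₀ h x hx y hy
    by_contra hlt
    rw [not_lt] at hlt
    rcases le_total (p y) (p x₀) with h' | h'
    · exact hd x₀ hx₀ (hY.2 y hy y₀ hy₀ x₀ (hX.1 hx₀) h' h)
    · exact hd y (hX.2 x₀ hx₀ x hx y (hY.1 hy) h' hlt) hy
  rcases le_total (p x₀) (p y₀) with h | h
  · exact Or.inl (key hX hY hd x₀ hx₀ y₀ hy₀ h)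
  · exact Or.inr fun x hx y hy => key hY hX (fun y hy hx => hd y hx hy) y₀ hy₀ x₀ hx₀ h y hy x hx

/-- The refinement of a preorder by a second one. -/
lemma exists_lexicographic_order (hE : E.Finite) (p c : α → ℤ) :
    ∃ q : α → ℤ, ∀ x ∈ E, ∀ y ∈ E, q x ≤ q y ↔ c x < c y ∨ (c x = c y ∧ p x ≤ p y) := by
  obtain ⟨N, hN⟩ : ∃ N : ℤ, ∀ x ∈ E, |p x| < N := by
    obtain ⟨N, hN⟩ := (hE.image fun x => |p x|).bddAbove
    exact ⟨N + 1, fun x hx => Int.lt_add_one_iff.2 (hN ⟨x, hx, rfl⟩)⟩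
  -- Values of p differ by less than 2N, so a unit step in c outweighs them.
  refine ⟨fun x => 2 * N * c x + p x, fun x hx y hy => ?_⟩
  have h1 := abs_lt.1 (hN x hx)
  have h2 := abs_lt.1 (hN y hy)
  have h0 : 0 < N := by linarith [h1.1, h1.2]
  simp only
  rcases lt_trichotomy (c x) (c y) with h | h | h
  · have : 2 * N * (c x + 1) ≤ 2 * N * c y := mul_le_mul_of_nonneg_left h (by linarith)
    constructor
    · exact fun _ => Or.inl h
    · intro _; linarith
  · rw [h]
    simp
  · have : 2 * N * (c y + 1) ≤ 2 * N * c x := mul_le_mul_of_nonneg_left h (by linarith)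
    constructor
    · intro _; linarith
    · rintro (h' | h')
      · omega
      · omega

lemma exists_equiv_fin_strictMono (hE : E.Finite) (hp : InjOn p E) :
    ∃ (n : ℕ) (f : Fin n ≃ E), StrictMono fun i => p (f i) := by
  classical
  set S : Finset ℤ := hE.toFinset.image p
  have hS : ∀ z, z ∈ S ↔ ∃ x ∈ E, p x = z := by simp [S]
  have hS' : ∀ z : S, ∃ x ∈ E, p x = z := fun z => (hS z).1 z.2
  choose g hgE hgp using hS'
  let e : S ≃ E :=
    { toFun := fun z => ⟨g z, hgE z⟩
      invFun := fun x => ⟨p x, (hS _).2 ⟨x, x.2, rfl⟩⟩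
      left_inv := fun z => Subtype.ext (hgp z)
      right_inv := fun x => Subtype.ext (hp (hgE _) x.2 (hgp _)) }
  refine ⟨S.card, (S.orderIsoOfFin rfl).toEquiv.trans e, fun i j hij => ?_⟩
  have hv : ∀ i, p ((S.orderIsoOfFin rfl).toEquiv.trans e i) = S.orderIsoOfFin rfl i :=
    fun i => hgp (S.orderIsoOfFin rfl i)
  simp only [hv]
  exact (S.orderIsoOfFin rfl).strictMono hij

lemma isIntervalHypergraph_of_isConvexIn (hE : E.Finite) (hp : InjOn p E) {𝓔 : Set (Set α)}
    (h : ∀ X ∈ 𝓔, IsConvexIn p E X ∧ X.Nonempty) : IsIntervalHypergraph E 𝓔 := by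
  classical
  obtain ⟨n, f, hf⟩ := exists_equiv_fin_strictMono hE hp
  refine ⟨n, f, fun X hX => ?_⟩
  obtain ⟨hc, x, hx⟩ := h X hX
  set T : Finset (Fin n) := Finset.univ.filter fun i => (f i : α) ∈ X
  have hT : ∀ i, i ∈ T ↔ (f i : α) ∈ X := by simp [T]
  have hpre : ∀ x ∈ X, ∃ i, (f i : α) = x := fun x hx => ⟨f.symm ⟨x, hc.1 hx⟩, by simp⟩
  obtain ⟨i₀, rfl⟩ := hpre x hx
  have hne : T.Nonempty := ⟨i₀, (hT _).2 hx⟩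
  refine ⟨T.min' hne, T.max' hne, Finset.min'_le_max' _ hne, ?_⟩
  ext y
  constructor
  · intro hy
    obtain ⟨i, rfl⟩ := hpre y hy
    exact ⟨i, ⟨Finset.min'_le _ _ ((hT i).2 hy), Finset.le_max' _ _ ((hT i).2 hy)⟩, rfl⟩
  · rintro ⟨i, hi, rfl⟩
    exact hc.2 _ ((hT _).1 (T.min'_mem hne)) _ ((hT _).1 (T.max'_mem hne)) _ (f i).2
      (hf.monotone hi.1) (hf.monotone hi.2)

lemma IsIntervalHypergraph.exists_order {𝓔 : Set (Set α)} (h : IsIntervalHypergraph E 𝓔) :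
    ∃ p : α → ℤ, InjOn p E ∧ ∀ X ∈ 𝓔, IsConvexIn p E X := by
  classical
  obtain ⟨n, f, hf⟩ := h
  set p : α → ℤ := fun x => if hx : x ∈ E then ((f.symm ⟨x, hx⟩ : Fin n) : ℕ) else 0
  have hp : ∀ i, p (f i) = ((i : ℕ) : ℤ) := by simp [p]
  have hsurj : ∀ x ∈ E, ∃ i, (f i : α) = x := fun x hx => ⟨f.symm ⟨x, hx⟩, by simp⟩
  refine ⟨p, ?_, fun X hX => ?_⟩
  · intro x hx y hy hxy
    obtain ⟨i, rfl⟩ := hsurj x hx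
    obtain ⟨j, rfl⟩ := hsurj y hy
    rw [hp, hp] at hxy
    rw [Fin.ext (by exact_mod_cast hxy : (i : ℕ) = j)]
  · obtain ⟨i, j, hij, rfl⟩ := hf X hX
    refine ⟨?_, ?_⟩
    · rintro _ ⟨k, -, rfl⟩
      exact (f k).2
    · rintro _ ⟨k, hk, rfl⟩ _ ⟨l, hl, rfl⟩ z hz h1 h2
      obtain ⟨t, rfl⟩ := hsurj z hz
      simp only [hp] at h1 h2
      refine ⟨t, ⟨hk.1.trans ?_, le_trans ?_ hl.2⟩, rfl⟩
      · rw [Fin.le_def]; exact_mod_cast h1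
      · rw [Fin.le_def]; exact_mod_cast h2

end Intervals

/-! ### Elementary properties of the clutters Y -/

section Labelled

variable {α : Type*} {d a b : ℕ} {v : α} {E A B C D : Set α} {𝓔 : Set (Set α)} {p : α → ℤ}

lemma IsPavingClutter.isPavingSystem (h : IsPavingClutter d E 𝓔) : IsPavingSystem d E 𝓔 := by
  obtain ⟨hd, N, hN, rfl, hr, hp, rfl⟩ := h
  exact isPavingSystem_dependentHyperplanes hr hp (by omega)

lemma IsPavingSystem.exists_notMem (h : IsPavingSystem d E 𝓔) (hA : A ∈ 𝓔) (hB : B ∈ 𝓔)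
    (hne : A ≠ B) : ∃ x ∈ A, x ∉ B := by
  by_contra hcon
  push Not at hcon
  have h1 := h.inter A hA B hB hne
  rw [inter_eq_left.2 hcon] at h1
  have := h.card A hA
  omega

lemma IsPavingSystem.mono (h : IsPavingSystem d E 𝓔) {𝓕 : Set (Set α)} (hs : 𝓕 ⊆ 𝓔) :
    IsPavingSystem d E 𝓕 :=
  ⟨h.finite, fun H hH => h.subset H (hs hH), fun H hH => h.card H (hs hH),
    fun H hH H' hH' => h.inter H (hs hH) H' (hs hH'), fun H hH => h.ne H (hs hH)⟩

lemma IsLabelledY.finite (h : IsLabelledY d a b v E A B C) : E.Finite :=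
  h.pavingClutter.isPavingSystem.finite

lemma IsLabelledY.subset_A (h : IsLabelledY d a b v E A B C) : A ⊆ E :=
  h.pavingClutter.isPavingSystem.subset A (by simp)

lemma IsLabelledY.subset_B (h : IsLabelledY d a b v E A B C) : B ⊆ E :=
  h.pavingClutter.isPavingSystem.subset B (by simp)

lemma IsLabelledY.subset_C (h : IsLabelledY d a b v E A B C) : C ⊆ E :=
  h.pavingClutter.isPavingSystem.subset C (by simp)

lemma IsLabelledY.eq_common (h : IsLabelledY d a b v E A B C) {x : α} (hA : x ∈ A) (hB : x ∈ B) :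
    x = v := by
  have hf := h.finite.subset h.subset_A
  by_cases hC : x ∈ C
  · obtain ⟨w, hw⟩ := ncard_eq_one.1 h.card_ABC
    have h1 : x ∈ ({w} : Set α) := hw ▸ ⟨⟨hA, hB⟩, hC⟩
    have h2 : v ∈ ({w} : Set α) := hw ▸ h.common
    rw [mem_singleton_iff] at h1 h2
    rw [h1, h2]
  · have h1 := (ncard_eq_zero ((hf.inter_of_left B).sdiff (t := C))).1 h.card_AB
    have : x ∈ (A ∩ B) \ C := ⟨⟨hA, hB⟩, hC⟩
    rw [h1] at this
    exact this.elim

lemma IsLabelledY.swap (h : IsLabelledY d a b v E A B C) : IsLabelledY d b a v E B A C where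
  pavingClutter := by
    have := h.pavingClutter
    rwa [insert_comm] at this
  a_le := h.b_le
  b_le := h.a_le
  no_isolated := fun x hx => by have := h.no_isolated x hx; tauto
  card_A := h.card_B
  card_B := h.card_A
  card_C := h.card_C
  card_AC := by rw [inter_comm]; exact h.card_CB
  card_CB := by rw [inter_comm]; exact h.card_AC
  card_AB := by rw [inter_comm]; exact h.card_AB
  card_C_only := by rw [union_comm]; exact h.card_C_only
  card_ABC := by rw [inter_comm B]; exact h.card_ABC
  large := by rw [union_comm]; exact h.large
  common := by rw [inter_comm B]; exact h.common

/-- Apart from v, the points of A shared with another edge number a ≤ d - 3, which is less than d -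
1. -/
lemma IsLabelledY.exists_A_only (h : IsLabelledY d a b v E A B C) :
    ∃ x ∈ A, x ∉ B ∧ x ∉ C := by
  have hf := h.finite.subset h.subset_A
  by_contra hcon
  push Not at hcon
  have hsub : A ⊆ insert v ((A ∩ C) \ B) := by
    intro x hx
    by_cases hxB : x ∈ B
    · exact Or.inl (h.eq_common hx hxB)
    · exact Or.inr ⟨⟨hx, hcon x hx hxB⟩, hxB⟩
  have h1 := ncard_le_ncard hsub ((hf.inter_of_left C).sdiff.insert v)
  have h2 := ncard_insert_le v ((A ∩ C) \ B)
  rw [h.card_AC] at h2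
  rw [h.card_A] at h1
  have := h.a_le
  omega

lemma IsLabelledY.exists_B_only (h : IsLabelledY d a b v E A B C) :
    ∃ x ∈ B, x ∉ A ∧ x ∉ C := h.swap.exists_A_only

lemma IsLabelledY.exists_C_only (h : IsLabelledY d a b v E A B C) :
    ∃ x ∈ C, x ∉ A ∧ x ∉ B := by
  obtain ⟨x, hx⟩ := nonempty_of_ncard_ne_zero h.card_C_only.ne'
  exact ⟨x, hx.1, fun h => hx.2 (Or.inl h), fun h => hx.2 (Or.inr h)⟩

end Labelled

/-! ### Every edge passes through the common point -/

section Necessity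

variable {α : Type*} {d a b : ℕ} {v x : α} {E A B C D P Q : Set α} {𝓔 : Set (Set α)} {p : α → ℤ}

/-- A paving system all of whose one-element minors are interval. -/
structure HasIntervalMinors (d : ℕ) (E : Set α) (𝓔 : Set (Set α)) : Prop
    extends IsPavingSystem d E 𝓔 where
  delete : ∀ x ∈ E, ∃ p : α → ℤ, InjOn p (E \ {x}) ∧
    ∀ H ∈ 𝓔, d ≤ (H \ {x}).ncard → IsConvexIn p (E \ {x}) (H \ {x})
  contract : ∀ x ∈ E, ∃ p : α → ℤ, InjOn p (E \ {x}) ∧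
    ∀ H ∈ 𝓔, x ∈ H → IsConvexIn p (E \ {x}) (H \ {x})

/-- An edge survives the deletion of `x` if it avoids `x` or has a point to spare; the lemmas below
use this disjunction. -/
lemma IsPavingSystem.le_ncard_sdiff (h : IsPavingSystem d E 𝓔) (hP : P ∈ 𝓔)
    (hx : x ∉ P ∨ d < P.ncard) : d ≤ (P \ {x}).ncard := by
  by_cases hxP : x ∈ P
  · have := ncard_sdiff_singleton_add_one hxP (h.finite.subset (h.subset P hP))
    have := hx.resolve_left (not_not.2 hxP)
    omega
  · rw [sdiff_singleton_eq_self hxP]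
    exact h.card P hP

lemma HasIntervalMinors.mem_of_delete (h : HasIntervalMinors d E 𝓔) (hP : P ∈ 𝓔) (hQ : Q ∈ 𝓔)
    (hD : D ∈ 𝓔) (hxE : x ∈ E) (hxP : x ∉ P ∨ d < P.ncard) (hxQ : x ∉ Q ∨ d < Q.ncard)
    (hxD : x ∉ D ∨ d < D.ncard) {u w : α} (hv : v ≠ x) (hu : u ≠ x) (hw : w ≠ x)
    (hvP : v ∈ P) (hvQ : v ∈ Q) (huD : u ∈ D) (huP : u ∈ P) (huQ : u ∉ Q) (hwD : w ∈ D)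
    (hwQ : w ∈ Q) (hwP : w ∉ P) : v ∈ D := by
  obtain ⟨p, -, hp⟩ := h.delete x hxE
  exact (mem_of_mem_sdiff_of_mem_sdiff (hp P hP (h.le_ncard_sdiff hP hxP))
    (hp Q hQ (h.le_ncard_sdiff hQ hxQ)) (hp D hD (h.le_ncard_sdiff hD hxD))
    ⟨hvP, hv⟩ ⟨hvQ, hv⟩ ⟨huD, hu⟩ ⟨huP, hu⟩ (fun h => huQ h.1) ⟨hwD, hw⟩ ⟨hwQ, hw⟩
    (fun h => hwP h.1)).1

lemma HasIntervalMinors.mem_of_contract (h : HasIntervalMinors d E 𝓔) (hP : P ∈ 𝓔) (hQ : Q ∈ 𝓔)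
    (hD : D ∈ 𝓔) (hxP : x ∈ P) (hxQ : x ∈ Q) (hxD : x ∈ D) {u w : α} (hv : v ≠ x) (hu : u ≠ x)
    (hw : w ≠ x) (hvP : v ∈ P) (hvQ : v ∈ Q) (huD : u ∈ D) (huP : u ∈ P) (huQ : u ∉ Q)
    (hwD : w ∈ D) (hwQ : w ∈ Q) (hwP : w ∉ P) : v ∈ D := by
  obtain ⟨p, -, hp⟩ := h.contract x (h.subset P hP hxP)
  exact (mem_of_mem_sdiff_of_mem_sdiff (hp P hP hxP) (hp Q hQ hxQ) (hp D hD hxD)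
    ⟨hvP, hv⟩ ⟨hvQ, hv⟩ ⟨huD, hu⟩ ⟨huP, hu⟩ (fun h => huQ h.1) ⟨hwD, hw⟩ ⟨hwQ, hw⟩
    (fun h => hwP h.1)).1

lemma HasIntervalMinors.false_of_delete (h : HasIntervalMinors d E 𝓔) (hA : A ∈ 𝓔) (hB : B ∈ 𝓔)
    (hD : D ∈ 𝓔) (hxE : x ∈ E) (hxA : x ∉ A) (hxB : x ∉ B) (hxD : x ∉ D ∨ d < D.ncard)
    {a b c : α} (hvx : v ≠ x) (hc' : c ≠ x) (hvA : v ∈ A) (hvB : v ∈ B) (hvD : v ∈ D)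
    (ha : a ∈ A) (haB : a ∉ B) (haD : a ∉ D) (hb : b ∈ B) (hbA : b ∉ A) (hbD : b ∉ D)
    (hc : c ∈ D) (hcA : c ∉ A) (hcB : c ∉ B) : False := by
  obtain ⟨p, -, hp⟩ := h.delete x hxE
  have ha' : a ≠ x := fun h => hxA (h ▸ ha)
  have hb' : b ≠ x := fun h => hxB (h ▸ hb)
  exact false_of_three_private (hp A hA (h.le_ncard_sdiff hA (Or.inl hxA)))
    (hp B hB (h.le_ncard_sdiff hB (Or.inl hxB))) (hp D hD (h.le_ncard_sdiff hD hxD))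
    ⟨hvA, hvx⟩ ⟨hvB, hvx⟩ ⟨hvD, hvx⟩ ⟨ha, ha'⟩ (fun h => haB h.1) (fun h => haD h.1)
    ⟨hb, hb'⟩ (fun h => hbA h.1) (fun h => hbD h.1) ⟨hc, hc'⟩ (fun h => hcA h.1) (fun h => hcB h.1)

/-- An edge that avoids the common point contains all private points. -/
lemma HasIntervalMinors.private_subset (h : HasIntervalMinors d E 𝓔)
    (hY : IsLabelledY d a b v E A B C) (hA : A ∈ 𝓔) (hB : B ∈ 𝓔) (hC : C ∈ 𝓔) (hD : D ∈ 𝓔)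
    (hDA : D ≠ A) (hDB : D ≠ B) (hDC : D ≠ C) (hv : v ∉ D) :
    (∀ x ∈ A, x ∉ C → x ≠ v → x ∈ D) ∧ (∀ x ∈ B, x ∉ C → x ≠ v → x ∈ D) ∧
      (∀ x ∈ C, x ∉ A → x ∉ B → x ∈ D) := by
  obtain ⟨⟨hvA, hvB⟩, hvC⟩ := hY.common
  have hAB : ∀ x, x ∈ A → x ∈ B → x = v := fun x => hY.eq_common
  have hcov : ∀ x ∈ D, x ∈ A ∨ x ∈ B ∨ x ∈ C := fun x hx => hY.no_isolated x (h.subset D hD hx)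
  obtain ⟨xA, hxA, hxAB, hxAC⟩ := hY.exists_A_only
  obtain ⟨xB, hxB, hxBA, hxBC⟩ := hY.exists_B_only
  obtain ⟨xC, hxC, hxCA, hxCB⟩ := hY.exists_C_only
  obtain ⟨yA, hyA, hyA'⟩ := h.exists_notMem hD hA hDA
  obtain ⟨yB, hyB, hyB'⟩ := h.exists_notMem hD hB hDB
  obtain ⟨yC, hyC, hyC'⟩ := h.exists_notMem hD hC hDC
  -- Deleting a point outside P, Q and D keeps all three as intervals, so D cannot meet both P \ Q
  -- and Q \ P while missing v.
  have key : ∀ P ∈ 𝓔, ∀ Q ∈ 𝓔, v ∈ P → v ∈ Q → ∀ x ∈ E, x ∉ P → x ∉ Q → x ∉ D →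
      ∀ u ∈ D, u ∈ P → u ∉ Q → ∀ w ∈ D, w ∈ Q → w ∉ P → False := by
    intro P hP Q hQ hvP hvQ x hxE hxP hxQ hxD u huD huP huQ w hwD hwQ hwP
    exact hv (h.mem_of_delete hP hQ hD hxE (Or.inl hxP) (Or.inl hxQ) (Or.inl hxD)
      (fun h => hxP (h ▸ hvP)) (fun h => hxP (h ▸ huP)) (fun h => hxQ (h ▸ hwQ)) hvP hvQ huD huP
      huQ hwD hwQ hwP)
  have k1 : (∀ x ∈ A, x ∉ C → x ≠ v → x ∈ D) ∨
      ∀ u ∈ D, u ∈ B → u ∉ C → ∀ w ∈ D, w ∈ C → w ∉ B → False := by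
    by_contra hcon
    push Not at hcon
    obtain ⟨⟨x, hx, hxC, hxv, hxD⟩, u, hu, huB, huC, w, hw, hwC, hwB, -⟩ := hcon
    exact key B hB C hC hvB hvC x (hY.subset_A hx) (fun h => hxv (hAB x hx h)) hxC hxD
      u hu huB huC w hw hwC hwB
  have k2 : (∀ x ∈ B, x ∉ C → x ≠ v → x ∈ D) ∨
      ∀ u ∈ D, u ∈ A → u ∉ C → ∀ w ∈ D, w ∈ C → w ∉ A → False := by
    by_contra hcon
    push Not at hcon
    obtain ⟨⟨x, hx, hxC, hxv, hxD⟩, u, hu, huB, huC, w, hw, hwC, hwB, -⟩ := hcon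
    exact key A hA C hC hvA hvC x (hY.subset_B hx) (fun h => hxv (hAB x h hx)) hxC hxD
      u hu huB huC w hw hwC hwB
  have k3 : (∀ x ∈ C, x ∉ A → x ∉ B → x ∈ D) ∨
      ∀ u ∈ D, u ∈ A → u ∉ B → ∀ w ∈ D, w ∈ B → w ∉ A → False := by
    by_contra hcon
    push Not at hcon
    obtain ⟨⟨x, hx, hxA, hxB, hxD⟩, u, hu, huB, huC, w, hw, hwC, hwB, -⟩ := hcon
    exact key A hA B hB hvA hvB x (hY.subset_C hx) hxA hxB hxD
      u hu huB huC w hw hwC hwB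
  have hnv : ∀ x ∈ D, x ≠ v := fun x hx he => hv (he ▸ hx)
  have hxAv : xA ≠ v := fun he => hxAB (he ▸ hvB)
  have hxBv : xB ≠ v := fun he => hxBA (he ▸ hvA)
  -- What remains is set combinatorics: D is covered by A, B, C, lies in none of them, misses v, and
  -- A ∩ B contains only v.
  clear key h hY hA hB hC hD hDA hDB hDC
  refine ⟨?_, ?_, ?_⟩ <;> rcases k1 with k1 | k1 <;> rcases k2 with k2 | k2 <;>
    rcases k3 with k3 | k3 <;> grind

/-- Every edge contains the common point. -/
lemma HasIntervalMinors.common_mem (h : HasIntervalMinors d E 𝓔)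
    (hY : IsLabelledY d a b v E A B C) (hA : A ∈ 𝓔) (hB : B ∈ 𝓔) (hC : C ∈ 𝓔) (hD : D ∈ 𝓔)
    (hDA : D ≠ A) (hDB : D ≠ B) (hDC : D ≠ C) : v ∈ D := by
  by_contra hv
  obtain ⟨⟨hvA, hvB⟩, hvC⟩ := hY.common
  have hAB : ∀ x, x ∈ A → x ∈ B → x = v := fun x => hY.eq_common
  have hf : ∀ X ∈ 𝓔, X.Finite := fun X hX => h.finite.subset (h.subset X hX)
  obtain ⟨xA, hxA, hxAB, hxAC⟩ := hY.exists_A_only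
  obtain ⟨xB, hxB, hxBA, hxBC⟩ := hY.exists_B_only
  obtain ⟨xC, hxC, hxCA, hxCB⟩ := hY.exists_C_only
  obtain ⟨pA, pB, pC⟩ := h.private_subset hY hA hB hC hD hDA hDB hDC hv
  have hxAD := pA xA hxA hxAC (fun he => hxAB (he ▸ hvB))
  have hxBD := pB xB hxB hxBC (fun he => hxBA (he ▸ hvA))
  have hxCD := pC xC hxC hxCA hxCB
  -- A larger D would survive the deletion of a private point of A, together with B and C.
  have hDc : D.ncard = d := by
    by_contra hne
    have hlt : d < D.ncard := lt_of_le_of_ne (h.card D hD) (Ne.symm hne)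
    exact hv (h.mem_of_delete (u := xB) (w := xC) hB hC hD (hY.subset_A hxA) (Or.inl hxAB) (Or.inl hxAC) (Or.inr hlt)
      (fun he => hxAB (he ▸ hvB)) (fun he => hxAB (he ▸ hxB)) (fun he => hxAC (he ▸ hxC))
      hvB hvC hxBD hxB hxBC hxCD hxC hxCB)
  -- Contracting a point common to A, C and D keeps all three as intervals, and D meets both A \ C
  -- and C \ A.
  have hACD : ∀ x ∈ A, x ∈ C → x ∉ D := fun x hx hxC' hxD =>
    hv (h.mem_of_contract (u := xA) (w := xC) hA hC hD hx hxC' hxD (fun he => hv (he ▸ hxD)) (fun he => hxAC (he ▸ hxC'))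
      (fun he => hxCA (he ▸ hx)) hvA hvC hxAD hxA hxAC hxCD hxC hxCA)
  have hBCD : ∀ x ∈ B, x ∈ C → x ∉ D := fun x hx hxC' hxD =>
    hv (h.mem_of_contract (u := xB) (w := xC) hB hC hD hx hxC' hxD (fun he => hv (he ▸ hxD)) (fun he => hxBC (he ▸ hxC'))
      (fun he => hxCB (he ▸ hx)) hvB hvC hxBD hxB hxBC hxCD hxC hxCB)
  -- Otherwise D would share the d - 1 points of A \ {v} with A. Deleting the resulting y will force
  -- |C| = d.
  have hAC : ∃ y ∈ A, y ∈ C ∧ y ≠ v := by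
    by_contra hcon
    push Not at hcon
    have hsub : A \ {v} ⊆ D ∩ A := fun x hx =>
      ⟨pA x hx.1 (fun hxC => hx.2 (hcon x hx.1 hxC)) hx.2, hx.1⟩
    have h1 := ncard_le_ncard hsub ((hf D hD).inter_of_left A)
    have h2 := ncard_sdiff_singleton_add_one hvA (hf A hA)
    have h3 := h.inter D hD A hA hDA
    rw [hY.card_A] at h2
    omega
  obtain ⟨y, hyA, hyC, hyv⟩ := hAC
  have hyB : y ∉ B := fun hyB => hyv (hAB y hyA hyB)
  have hCc : C.ncard = d := by
    by_contra hne
    have hlt : d < C.ncard := lt_of_le_of_ne (h.card C hC) (Ne.symm hne)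
    exact hv (h.mem_of_delete (u := xB) (w := xC) hB hC hD (hY.subset_A hyA) (Or.inl hyB) (Or.inr hlt)
      (Or.inl (hACD y hyA hyC)) hyv.symm (fun he => hyB (he ▸ hxB)) (fun he => hxCA (he ▸ hyA))
      hvB hvC hxBD hxB hxBC hxCD hxC hxCB)
  have e1 := ncard_inter_add_ncard_sdiff_eq_ncard A C (hf A hA)
  have e2 := ncard_inter_add_ncard_sdiff_eq_ncard B C (hf B hB)
  have e3 := ncard_inter_add_ncard_sdiff_eq_ncard C A (hf C hC)
  have e4 := ncard_inter_add_ncard_sdiff_eq_ncard (C \ A) B (hf C hC).sdiff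
  have e5 := ncard_inter_add_ncard_sdiff_eq_ncard D A (hf D hD)
  have e6 := ncard_inter_add_ncard_sdiff_eq_ncard (D \ A) B (hf D hD).sdiff
  have hcov : ∀ x ∈ D, x ∈ A ∨ x ∈ B ∨ x ∈ C := fun x hx => hY.no_isolated x (h.subset D hD hx)
  have hnv : ∀ x ∈ D, x ≠ v := fun x hx he => hv (he ▸ hx)
  have s1 : (C \ A) ∩ B = (B ∩ C) \ {v} := by
    ext x
    simp only [mem_inter_iff, mem_sdiff, mem_singleton_iff]
    grind
  have s2 : D ∩ A = A \ C := by
    ext x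
    simp only [mem_inter_iff, mem_sdiff]
    grind
  have s3 : (D \ A) ∩ B = B \ C := by
    ext x
    simp only [mem_inter_iff, mem_sdiff]
    grind
  have s4 : (D \ A) \ B = (C \ A) \ B := by
    ext x
    simp only [mem_sdiff]
    grind
  have e7 := ncard_sdiff_singleton_add_one (mem_inter hvB hvC) ((hf B hB).inter_of_left C)
  rw [s1] at e4
  rw [s2] at e5
  rw [s3, s4] at e6
  rw [inter_comm C A] at e3
  rw [hY.card_A] at e1
  rw [hY.card_B] at e2
  -- Now D is the disjoint union of A \ C, B \ C and C \ (A ∪ B). With all sizes equal to d this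
  -- gives 2(|A ∩ C| + |B ∩ C|) = 2d + 1, which is impossible by parity.
  omega

end Necessity

/-! ### Private points in the middle, and the shape of the remaining edges -/

section Middle

variable {α : Type*} {d a b : ℕ} {v : α} {E A B C D : Set α} {𝓔 : Set (Set α)} {p : α → ℤ}

/-- In the order on `E \ {v}` given by `p`, the points outside `A ∪ B` lie between those of `A`
and those of `B`. -/
def IsMiddle (p : α → ℤ) (v : α) (E A B : Set α) : Prop :=
  ∀ x ∈ A, x ≠ v → ∀ w ∈ E, w ∉ A → w ∉ B → ∀ y ∈ B, y ≠ v → p x < p w ∧ p w < p y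

lemma IsMiddle.neg (h : IsMiddle p v E A B) : IsMiddle (-p) v E B A :=
  fun x hx hxv w hw hwB hwA y hy hyv =>
    ⟨neg_lt_neg (h y hy hyv w hw hwA hwB x hx hxv).2, neg_lt_neg (h y hy hyv w hw hwA hwB x hx hxv).1⟩

/-- If a private point of `C` precedes `A`, which precedes `B`, then `C` and `B` are disjoint apart
from `v`, and all private points of `C` precede `A`. -/
lemma IsLabelledY.precede (hY : IsLabelledY d a b v E A B C)
    (hA : IsConvexIn p (E \ {v}) (A \ {v})) (hC : IsConvexIn p (E \ {v}) (C \ {v}))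
    (hAB : ∀ x ∈ A \ {v}, ∀ y ∈ B \ {v}, p x < p y) {w x : α} (hwE : w ∈ E) (hwA : w ∉ A)
    (hwB : w ∉ B) (hxA : x ∈ A \ {v}) (hwx : p w ≤ p x) :
    (∀ y ∈ A \ {v}, p w < p y) ∧ (∀ y ∈ C, y ∈ B → y = v) ∧
      ∀ u ∈ C \ {v}, ∀ y ∈ A \ {v}, y ∉ C → p u < p y := by
  obtain ⟨⟨hvA, hvB⟩, hvC⟩ := hY.common
  have hwv : w ≠ v := fun he => hwA (he ▸ hvA)
  have hwC : w ∈ C := ((hY.no_isolated w hwE).resolve_left hwA).resolve_left hwB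
  have h1 : ∀ y ∈ A \ {v}, p w < p y := by
    intro y hy
    by_contra hlt
    exact hwA (hA.2 y hy x hxA w ⟨hwE, hwv⟩ (not_lt.1 hlt) hwx).1
  obtain ⟨xA, hxA', hxAB, hxAC⟩ := hY.exists_A_only
  have hxAv : xA ∈ A \ {v} := ⟨hxA', fun he => hxAC (by rw [he]; exact hvC)⟩
  refine ⟨h1, ?_, ?_⟩
  · intro y hyC hyB
    by_contra hyv
    exact hxAC (hC.2 w ⟨hwC, hwv⟩ y ⟨hyC, hyv⟩ xA (hA.1 hxAv) (h1 xA hxAv).le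
      (hAB xA hxAv y ⟨hyB, hyv⟩).le).1
  · intro u hu y hy hyC
    by_contra hlt
    exact hyC (hC.2 w ⟨hwC, hwv⟩ u hu y (hA.1 hy) (h1 y hy).le (not_lt.1 hlt)).1

/-- If a private point of `C` precedes `A`, then `A` and `C` can be interchanged. -/
lemma IsLabelledY.interchange (hY : IsLabelledY d a b v E A B C)
    (hA : IsConvexIn p (E \ {v}) (A \ {v})) (hC : IsConvexIn p (E \ {v}) (C \ {v}))
    (hAB : ∀ x ∈ A \ {v}, ∀ y ∈ B \ {v}, p x < p y) {w x : α} (hwE : w ∈ E) (hwA : w ∉ A)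
    (hwB : w ∉ B) (hxA : x ∈ A \ {v}) (hwx : p w ≤ p x) :
    IsLabelledY d a b v E C B A ∧ IsMiddle p v E C B := by
  obtain ⟨⟨hvA, hvB⟩, hvC⟩ := hY.common
  obtain ⟨h1, h2, h3⟩ := hY.precede hA hC hAB hwE hwA hwB hxA hwx
  have hCf := hY.finite.subset hY.subset_C
  obtain ⟨xA, hxA', hxAB, hxAC⟩ := hY.exists_A_only
  have hCB : ∀ X : Set α, (C ∩ B) \ X = {v} \ X := by
    intro X
    ext y
    constructor
    · exact fun hy => ⟨h2 y hy.1.1 hy.1.2, hy.2⟩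
    · rintro ⟨rfl, hy⟩
      exact ⟨⟨hvC, hvB⟩, hy⟩
  have hb : b = 0 := by
    rw [← hY.card_CB, hCB, sdiff_eq_empty.2 (singleton_subset_iff.2 hvA), ncard_empty]
  -- If |C| > d, then C has a single private point and meets B only in v, so |C| ≤ a + 2 < d.
  have hCc : C.ncard = d := by
    by_contra hne
    have h4 := hY.large (lt_of_le_of_ne hY.card_C (Ne.symm hne))
    have h5 : C ⊆ insert v (((A ∩ C) \ B) ∪ (C \ (A ∪ B))) := by
      intro y hy
      by_cases hyB : y ∈ B
      · exact Or.inl (h2 y hy hyB)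
      · by_cases hyA : y ∈ A
        · exact Or.inr (Or.inl ⟨⟨hyA, hy⟩, hyB⟩)
        · exact Or.inr (Or.inr ⟨hy, by simp [hyA, hyB]⟩)
    have h6 := ncard_le_ncard h5
      (((hCf.inter_of_right A).sdiff.union hCf.sdiff).insert v)
    have h7 := ncard_insert_le v (((A ∩ C) \ B) ∪ (C \ (A ∪ B)))
    have h8 := ncard_union_le ((A ∩ C) \ B) (C \ (A ∪ B))
    rw [hY.card_AC] at h8
    have := hY.a_le
    have := hY.card_C
    omega
  refine ⟨?_, ?_⟩
  · refine
      { pavingClutter := ?_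
        a_le := hY.a_le
        b_le := hY.b_le
        no_isolated := fun x hx => by have := hY.no_isolated x hx; tauto
        card_A := hCc
        card_B := hY.card_B
        card_C := hY.card_A.ge
        card_AC := by rw [inter_comm]; exact hY.card_AC
        card_CB := ?_
        card_AB := ?_
        card_C_only := ?_
        card_ABC := ?_
        large := fun h => absurd hY.card_A h.ne'
        common := ⟨⟨hvC, hvB⟩, hvA⟩ }
    · have : ({C, B, A} : Set (Set α)) = {A, B, C} := by
        ext X; simp only [mem_insert_iff, mem_singleton_iff]; tauto
      rw [this]
      exact hY.pavingClutter
    · rw [hb]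
      have : (A ∩ B) \ C = ∅ := by
        rw [eq_empty_iff_forall_notMem]
        rintro y ⟨⟨hyA, hyB⟩, hyC⟩
        exact hyC (by rw [hY.eq_common hyA hyB]; exact hvC)
      rw [this, ncard_empty]
    · rw [hCB, sdiff_eq_empty.2 (singleton_subset_iff.2 hvA), ncard_empty]
    · rw [Nat.pos_iff_ne_zero, ne_eq, ncard_eq_zero ((hY.finite.subset hY.subset_A).sdiff)]
      refine Nonempty.ne_empty ⟨xA, hxA', ?_⟩
      rintro (h | h)
      · exact hxAC h
      · exact hxAB h
    · rw [show C ∩ B ∩ A = A ∩ B ∩ C by ext; simp; tauto]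
      exact hY.card_ABC
  · intro u hu huv z hz hzC hzB y hy hyv
    have hzA : z ∈ A := by have := hY.no_isolated z hz; tauto
    have hzv : z ≠ v := fun he => hzC (by rw [he]; exact hvC)
    exact ⟨h3 u ⟨hu, huv⟩ z ⟨hzA, hzv⟩ hzC, hAB z ⟨hzA, hzv⟩ y ⟨hy, hyv⟩⟩

/-- After a suitable renaming, the private points of `C` lie between `A` and `B`. -/
lemma IsLabelledY.exists_isMiddle (hY : IsLabelledY d a b v E A B C)
    (hA : IsConvexIn p (E \ {v}) (A \ {v})) (hB : IsConvexIn p (E \ {v}) (B \ {v}))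
    (hC : IsConvexIn p (E \ {v}) (C \ {v})) (hAB : ∀ x ∈ A \ {v}, ∀ y ∈ B \ {v}, p x < p y) :
    ∃ A' B' C' : Set α, ({A', B', C'} : Set (Set α)) = {A, B, C} ∧ IsLabelledY d a b v E A' B' C' ∧
      IsMiddle p v E A' B' := by
  by_cases h1 : ∃ w ∈ E, w ∉ A ∧ w ∉ B ∧ ∃ x ∈ A \ {v}, p w ≤ p x
  · obtain ⟨w, hwE, hwA, hwB, x, hx, hwx⟩ := h1
    obtain ⟨h, h'⟩ := hY.interchange hA hC hAB hwE hwA hwB hx hwx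
    refine ⟨C, B, A, ?_, h, h'⟩
    ext X; simp only [mem_insert_iff, mem_singleton_iff]; tauto
  by_cases h2 : ∃ w ∈ E, w ∉ A ∧ w ∉ B ∧ ∃ x ∈ B \ {v}, p x ≤ p w
  · obtain ⟨w, hwE, hwA, hwB, x, hx, hwx⟩ := h2
    obtain ⟨h, h'⟩ := hY.swap.interchange hB.neg hC.neg
      (fun x hx y hy => neg_lt_neg (hAB y hy x hx)) hwE hwB hwA hx (neg_le_neg hwx)
    refine ⟨A, C, B, ?_, h.swap, ?_⟩
    · ext X; simp only [mem_insert_iff, mem_singleton_iff]; tauto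
    · simpa using h'.neg
  · push Not at h1 h2
    exact ⟨A, B, C, rfl, hY, fun x hx hxv w hw hwA hwB y hy hyv =>
      ⟨h1 w hw hwA hwB x ⟨hx, hxv⟩, h2 w hw hwA hwB y ⟨hy, hyv⟩⟩⟩

lemma IsLabelledY.disjoint_sdiff (hY : IsLabelledY d a b v E A B C) :
    ∀ x ∈ A \ {v}, x ∉ B \ {v} := fun _ hx hxB => hx.2 (hY.eq_common hx.1 hxB.1)

lemma IsLabelledY.exists_mem_A (hY : IsLabelledY d a b v E A B C) : ∃ x, x ∈ A \ {v} := by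
  obtain ⟨x, hx, -, hxC⟩ := hY.exists_A_only
  exact ⟨x, hx, fun he => hxC (by rw [he]; exact hY.common.2)⟩

/-- A \ {v} and B \ {v} are disjoint intervals, hence comparable; the order is reversed if B comes
first. -/
lemma IsLabelledY.exists_order_isMiddle (hY : IsLabelledY d a b v E A B C)
    (hp : InjOn p (E \ {v})) {𝓔 : Set (Set α)} (hA : A ∈ 𝓔) (hB : B ∈ 𝓔) (hC : C ∈ 𝓔)
    (hpc : ∀ H ∈ 𝓔, IsConvexIn p (E \ {v}) (H \ {v})) :
    ∃ (A' B' C' : Set α) (q : α → ℤ), ({A', B', C'} : Set (Set α)) = {A, B, C} ∧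
      IsLabelledY d a b v E A' B' C' ∧ IsMiddle q v E A' B' ∧ InjOn q (E \ {v}) ∧
      ∀ H ∈ 𝓔, IsConvexIn q (E \ {v}) (H \ {v}) := by
  obtain ⟨x, hx⟩ := hY.exists_mem_A
  obtain ⟨y, hy⟩ := hY.swap.exists_mem_A
  have hpn : InjOn (-p) (E \ {v}) := fun x hx y hy hxy => hp hx hy (neg_inj.1 hxy)
  rcases (hpc A hA).lt_or_gt (hpc B hB) hY.disjoint_sdiff hx hy with h | h
  · obtain ⟨A', B', C', h1, h2, h3⟩ := hY.exists_isMiddle (hpc A hA) (hpc B hB) (hpc C hC) h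
    exact ⟨A', B', C', p, h1, h2, h3, hp, hpc⟩
  · obtain ⟨A', B', C', h1, h2, h3⟩ := hY.exists_isMiddle (hpc A hA).neg (hpc B hB).neg
      (hpc C hC).neg (fun x hx y hy => neg_lt_neg (h x hx y hy))
    exact ⟨A', B', C', -p, h1, h2, h3, hpn, fun H hH => (hpc H hH).neg⟩

/-- The points of an edge `D` do not all precede a point outside `A ∪ B`. -/
lemma HasIntervalMinors.not_forall_lt (h : HasIntervalMinors d E 𝓔)
    (hY : IsLabelledY d a b v E A B C) (hA : A ∈ 𝓔) (hB : B ∈ 𝓔) (hD : D ∈ 𝓔) (hDA : D ≠ A)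
    (hvD : v ∈ D) (hmid : IsMiddle p v E A B)
    {w : α} (hw : w ∈ E) (hwA : w ∉ A) (hwB : w ∉ B) : ¬ ∀ x ∈ D \ {v}, p x < p w := by
  intro hlt
  obtain ⟨⟨hvA, hvB⟩, hvC⟩ := hY.common
  have hwv : v ≠ w := fun he => hwA (by rw [← he]; exact hvA)
  have hwD : w ∉ D := fun hwD => lt_irrefl _ (hlt w ⟨hwD, hwv.symm⟩)
  obtain ⟨x, hx⟩ := hY.exists_mem_A
  have hBD : ∀ y ∈ B, y ≠ v → y ∉ D := fun y hy hyv hyD =>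
    lt_asymm (hlt y ⟨hyD, hyv⟩) (hmid x hx.1 hx.2 w hw hwA hwB y hy hyv).2
  obtain ⟨y, hy⟩ := hY.swap.exists_mem_A
  obtain ⟨u, huD, huA⟩ := h.exists_notMem hD hA hDA
  obtain ⟨z, hzA, hzD⟩ := h.exists_notMem hA hD hDA.symm
  have huv : u ≠ v := fun he => huA (by rw [he]; exact hvA)
  have hzv : z ≠ v := fun he => hzD (by rw [he]; exact hvD)
  -- Since D stays before w, it meets B only in v. So A, B and D all survive the deletion of w and
  -- have private points.
  exact h.false_of_delete hA hB hD hw hwA hwB (Or.inl hwD) hwv (fun he => hwD (he ▸ huD)) hvA hvB hvD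
    hzA (fun hzB => hzv (hY.eq_common hzA hzB)) hzD hy.1 (fun hyA => hy.2 (hY.eq_common hyA hy.1))
    (hBD y hy.1 hy.2) huD huA (fun huB => hBD u huB huv huD)

/-- If the private points of `C` lie between `A` and `B`, then any edge can play the role of
`C`. -/
lemma HasIntervalMinors.isLabelledY (h : HasIntervalMinors d E 𝓔)
    (hY : IsLabelledY d a b v E A B C) (hA : A ∈ 𝓔) (hB : B ∈ 𝓔) (hD : D ∈ 𝓔) (hDA : D ≠ A)
    (hDB : D ≠ B) (hvD : v ∈ D) (hmid : IsMiddle p v E A B)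
    (hpD : IsConvexIn p (E \ {v}) (D \ {v})) :
    IsLabelledY d ((A ∩ D) \ B).ncard ((D ∩ B) \ A).ncard v E A B D := by
  obtain ⟨⟨hvA, hvB⟩, hvC⟩ := hY.common
  have hAB : ∀ x, x ∈ A → x ∈ B → x = v := fun x => hY.eq_common
  have hf : ∀ X ∈ 𝓔, X.Finite := fun X hX => h.finite.subset (h.subset X hX)
  -- An interval missing w lies on one side of w, and neither side is possible for D.
  have hW : ∀ w ∈ E, w ∉ A → w ∉ B → w ∈ D := by
    intro w hw hwA hwB
    by_contra hwD
    have hwv : w ≠ v := fun he => hwA (by rw [he]; exact hvA)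
    by_cases h1 : ∀ x ∈ D \ {v}, p x < p w
    · exact h.not_forall_lt hY hA hB hD hDA hvD hmid hw hwA hwB h1
    · by_cases h2 : ∀ x ∈ D \ {v}, p w < p x
      · exact h.not_forall_lt hY.swap hB hA hD hDB hvD hmid.neg hw hwB hwA
          fun x hx => neg_lt_neg (h2 x hx)
      · push Not at h1 h2
        obtain ⟨x, hx, hwx⟩ := h1
        obtain ⟨y, hy, hyw⟩ := h2
        exact hwD (hpD.2 y hy x hx w ⟨hw, hwv⟩ hyw hwx).1
  obtain ⟨xC, hxC, hxCA, hxCB⟩ := hY.exists_C_only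
  have hxD := hW xC (hY.subset_C hxC) hxCA hxCB
  have hle : ∀ X ∈ 𝓔, v ∈ X → D ≠ X → ∀ Y, v ∈ Y → ((D ∩ X) \ Y).ncard + 3 ≤ d := by
    intro X hX hvX hne Y hvY
    have h1 : (D ∩ X) \ Y ⊆ (D ∩ X) \ {v} := sdiff_subset_sdiff_right (singleton_subset_iff.2 hvY)
    have hf' := (hf D hD).inter_of_left X
    have h2 := ncard_le_ncard h1 hf'.sdiff
    have h3 := ncard_sdiff_singleton_add_one (mem_inter hvD hvX) hf'
    have h4 := h.inter D hD X hX hne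
    omega
  have hDf := hf D hD
  refine
    { pavingClutter := ?_
      a_le := by rw [inter_comm]; exact hle A hA hvA hDA B hvB
      b_le := hle B hB hvB hDB A hvA
      no_isolated := fun x hx => by have := hW x hx; tauto
      card_A := hY.card_A
      card_B := hY.card_B
      card_C := h.card D hD
      card_AC := rfl
      card_CB := rfl
      card_AB := ?_
      card_C_only := ?_
      card_ABC := ?_
      large := fun hlt => ?_
      common := ⟨⟨hvA, hvB⟩, hvD⟩ }
  · refine (h.toIsPavingSystem.mono ?_).isPavingClutter hY.pavingClutter.1 ⟨A, by simp⟩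
    rintro X (rfl | rfl | rfl) <;> assumption
  · have : (A ∩ B) \ D = ∅ := by
      rw [eq_empty_iff_forall_notMem]
      rintro y ⟨⟨hyA, hyB⟩, hyD⟩
      exact hyD (by rw [hAB y hyA hyB]; exact hvD)
    rw [this, ncard_empty]
  · rw [Nat.pos_iff_ne_zero, ne_eq, ncard_eq_zero hDf.sdiff]
    refine Nonempty.ne_empty ⟨xC, hxD, ?_⟩
    rintro (h | h)
    · exact hxCA h
    · exact hxCB h
  · have : A ∩ B ∩ D = {v} := by
      ext y
      constructor
      · exact fun hy => hAB y hy.1.1 hy.1.2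
      · rintro rfl
        exact ⟨⟨hvA, hvB⟩, hvD⟩
    rw [this, ncard_singleton]
  -- If |D| > d and D had a second private point, deleting it would keep A, B and D, each still with
  -- a private point.
  · rw [ncard_eq_one]
    refine ⟨xC, Subset.antisymm ?_ ?_⟩
    · rintro x ⟨hx, hxAB⟩
      by_contra hne
      have hxA : x ∉ A := fun h => hxAB (Or.inl h)
      have hxB : x ∉ B := fun h => hxAB (Or.inr h)
      obtain ⟨z, hzA, hzD⟩ := h.exists_notMem hA hD hDA.symm
      obtain ⟨y, hyB, hyD⟩ := h.exists_notMem hB hD hDB.symm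
      have hzv : z ≠ v := fun he => hzD (by rw [he]; exact hvD)
      have hyv : y ≠ v := fun he => hyD (by rw [he]; exact hvD)
      exact h.false_of_delete hA hB hD (h.subset D hD hx) hxA hxB (Or.inr hlt)
        (fun he => hxA (by rw [← he]; exact hvA)) (fun he => hne he.symm) hvA hvB hvD
        hzA (fun hzB => hzv (hAB z hzA hzB)) hzD hyB (fun hyA => hyv (hAB y hyA hyB)) hyD
        hxD hxCA hxCB
    · rintro _ rfl
      exact ⟨hxD, by simp [hxCA, hxCB]⟩

/-- The clutter obtained by removing a common point of all edges. -/
lemma IsPavingSystem.sdiff_common (h : IsPavingSystem d E 𝓔) (hv : ∀ H ∈ 𝓔, v ∈ H) :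
    IsPavingSystem (d - 1) (E \ {v}) ((fun X => X \ {v}) '' 𝓔) := by
  have hf : ∀ X ∈ 𝓔, X.Finite := fun X hX => h.finite.subset (h.subset X hX)
  refine ⟨h.finite.sdiff, ?_, ?_, ?_, ?_⟩
  · rintro _ ⟨X, hX, rfl⟩
    exact sdiff_subset_sdiff_left (h.subset X hX)
  · rintro _ ⟨X, hX, rfl⟩
    have h1 := ncard_sdiff_singleton_add_one (hv X hX) (hf X hX)
    have h2 := h.card X hX
    simp only
    omega
  · rintro _ ⟨X, hX, rfl⟩ _ ⟨Y, hY, rfl⟩ hne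
    have h1 := ncard_sdiff_singleton_add_one (mem_inter (hv X hX) (hv Y hY))
      ((hf X hX).inter_of_left Y)
    have h2 := h.inter X hX Y hY fun he => hne (by rw [he])
    have : X \ {v} ∩ (Y \ {v}) = (X ∩ Y) \ {v} := by ext; simp; tauto
    simp only [this]
    omega
  · rintro _ ⟨X, hX, rfl⟩ he
    refine h.ne X hX ?_
    rw [← insert_sdiff_self_of_mem (hv X hX), ← insert_sdiff_self_of_mem (h.subset X hX (hv X hX))]
    simp only at he
    rw [he]

lemma IsPavingSystem.isAntichain (h : IsPavingSystem d E 𝓔) :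
    IsAntichain (· ⊆ ·) 𝓔 := by
  intro X hX Y hY hne hs
  obtain ⟨x, hx, hxY⟩ := h.exists_notMem hX hY hne
  exact hxY (hs hx)

/-- Conditions 1 and 2 are necessary. -/
lemma HasIntervalMinors.exists_isYFamily (h : HasIntervalMinors d E 𝓔)
    (hY : IsLabelledY d a b v E A B C) (hA : A ∈ 𝓔) (hB : B ∈ 𝓔) (hC : C ∈ 𝓔) :
    ∃ A' B' C' : Set α, ({A', B', C'} : Set (Set α)) = {A, B, C} ∧
      IsLabelledY d a b v E A' B' C' ∧
      (∀ D ∈ 𝓔, D ∉ ({A, B, C} : Set (Set α)) →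
        IsLabelledY d ((A' ∩ D) \ B').ncard ((D ∩ B') \ A').ncard v E A' B' D) ∧
      IsIntervalClutter (E \ {v}) ((fun X => X \ {v}) '' 𝓔) ∧
      IsPavingClutter (d - 1) (E \ {v}) ((fun X => X \ {v}) '' 𝓔) := by
  obtain ⟨⟨hvA, hvB⟩, hvC⟩ := hY.common
  have hv : ∀ D ∈ 𝓔, v ∈ D := by
    intro D hD
    by_cases h1 : D = A
    · rwa [h1]
    by_cases h2 : D = B
    · rwa [h2]
    by_cases h3 : D = C
    · rwa [h3]
    exact h.common_mem hY hA hB hC hD h1 h2 h3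
  have hd : 3 ≤ d := by have := hY.a_le; omega
  obtain ⟨p, hpi, hp⟩ := h.contract v (hY.subset_A hvA)
  obtain ⟨A', B', C', q, h1, h2, h3, hqi, hq⟩ := hY.exists_order_isMiddle hpi hA hB hC
    (fun H hH => hp H hH (hv H hH))
  have hsub : ∀ X ∈ ({A', B', C'} : Set (Set α)), X ∈ 𝓔 := by
    rw [h1]
    rintro X (rfl | rfl | rfl) <;> assumption
  have hs := h.toIsPavingSystem.sdiff_common hv
  have hA' := hsub A' (by simp)
  have hB' := hsub B' (by simp)
  refine ⟨A', B', C', h1, h2, fun D hD hne => ?_, ⟨hs.isAntichain, ?_⟩, ?_⟩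
  · rw [← h1] at hne
    exact h.isLabelledY h2 hA' hB' hD (fun he => hne (by simp [he])) (fun he => hne (by simp [he]))
      (hv D hD) h3 (hq D hD)
  · refine isIntervalHypergraph_of_isConvexIn hs.finite hqi ?_
    rintro _ ⟨X, hX, rfl⟩
    have hc : d - 1 ≤ (X \ {v}).ncard := hs.card _ (mem_image_of_mem _ hX)
    have hc' : (X \ {v}).ncard ≠ 0 := by omega
    exact ⟨hq X hX, nonempty_of_ncard_ne_zero hc'⟩
  · exact hs.isPavingClutter (by omega) ⟨_, mem_image_of_mem _ hA⟩

end Middle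

/-! ### Reinserting the common point into the order -/

section Sufficiency

open scoped Matroid

variable {α ι : Type*} {d : ℕ} {v x : α} {E A B : Set α} {C : ι → Set α} {a b : ι → ℕ} {p : α → ℤ}

/-- With at least two sets `C i`, their private points lie between `A` and `B`. -/
lemma exists_isMiddle_of_ne (hY : ∀ i, IsLabelledY d (a i) (b i) v E A B (C i)) {i j : ι}
    (hij : ¬ C i ⊆ C j) (hji : ¬ C j ⊆ C i) (hA : IsConvexIn p (E \ {v}) (A \ {v}))
    (hB : IsConvexIn p (E \ {v}) (B \ {v})) (hC : ∀ i, IsConvexIn p (E \ {v}) (C i \ {v})) :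
    IsMiddle p v E A B ∨ IsMiddle p v E B A := by
  have key : ∀ {A B : Set α} {a b : ι → ℕ} {p : α → ℤ},
      (∀ i, IsLabelledY d (a i) (b i) v E A B (C i)) → IsConvexIn p (E \ {v}) (A \ {v}) →
      (∀ i, IsConvexIn p (E \ {v}) (C i \ {v})) →
      (∀ x ∈ A \ {v}, ∀ y ∈ B \ {v}, p x < p y) →
      ∀ w ∈ E, w ∉ A → w ∉ B → ∀ x ∈ A \ {v}, p x < p w := by
    intro A B a b p hY hA hC hAB w hwE hwA hwB x hx
    by_contra hlt
    rw [not_lt] at hlt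
    obtain ⟨⟨hvA, hvB⟩, hvi⟩ := (hY i).common
    have hvj := (hY j).common.2
    have hwv : w ≠ v := fun he => hwA (by rw [he]; exact hvA)
    have hpr := fun k => (hY k).precede hA (hC k) hAB hwE hwA hwB hx hlt
    have hwC : ∀ k, w ∈ C k := fun k =>
      (((hY k).no_isolated w hwE).resolve_left hwA).resolve_left hwB
    -- If w precedes A, any two of the sets C k can differ only inside A. All of them start at w or
    -- earlier, so they would be nested.
    have hmem : ∀ k l, ∀ y ∈ C k, y ∉ C l → y ∈ A \ {v} := by
      intro k l y hy hyl
      have hyv : y ≠ v := fun he => hyl (by rw [he]; exact (hY l).common.2)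
      have hyB : y ∉ B := fun hyB => hyv ((hpr k).2.1 y hy hyB)
      have := (hY l).no_isolated y ((hY k).subset_C hy)
      exact ⟨by tauto, hyv⟩
    obtain ⟨y, hyi, hyj⟩ := not_subset.1 hij
    obtain ⟨z, hzj, hzi⟩ := not_subset.1 hji
    have hyA := hmem i j y hyi hyj
    have hzA := hmem j i z hzj hzi
    rcases le_total (p y) (p z) with hle | hle
    · exact hyj ((hC j).2 w ⟨hwC j, hwv⟩ z ⟨hzj, hzA.2⟩ y (hA.1 hyA)
        ((hpr i).1 y hyA).le hle).1
    · exact hzi ((hC i).2 w ⟨hwC i, hwv⟩ y ⟨hyi, hyA.2⟩ z (hA.1 hzA)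
        ((hpr i).1 z hzA).le hle).1
  have key2 : ∀ {A B : Set α} {a b : ι → ℕ} {p : α → ℤ},
      (∀ i, IsLabelledY d (a i) (b i) v E A B (C i)) → IsConvexIn p (E \ {v}) (A \ {v}) →
      IsConvexIn p (E \ {v}) (B \ {v}) → (∀ i, IsConvexIn p (E \ {v}) (C i \ {v})) →
      (∀ x ∈ A \ {v}, ∀ y ∈ B \ {v}, p x < p y) → IsMiddle p v E A B := by
    intro A B a b p hY hA hB hC hAB x hx hxv w hw hwA hwB y hy hyv
    refine ⟨key hY hA hC hAB w hw hwA hwB x ⟨hx, hxv⟩, ?_⟩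
    exact neg_lt_neg_iff.1 (key (fun i => (hY i).swap) hB.neg (fun i => (hC i).neg)
      (fun x hx y hy => neg_lt_neg (hAB y hy x hx)) w hw hwB hwA y ⟨hy, hyv⟩)
  obtain ⟨x, hx⟩ := (hY i).exists_mem_A
  obtain ⟨y, hy⟩ := (hY i).swap.exists_mem_A
  rcases hA.lt_or_gt hB (hY i).disjoint_sdiff hx hy with h | h
  · exact Or.inl (key2 hY hA hB hC h)
  · exact Or.inr (key2 (fun i => (hY i).swap) hB hA hC fun x hx y hy => h y hy x hx)

/-- The point `v` can be put between `A` and the points outside `A ∪ B`. -/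
lemma IsMiddle.exists_order (hmid : IsMiddle p v E A B) (hY : ∀ i, IsLabelledY d (a i) (b i) v E A B (C i))
    (i₀ : ι) (hp : InjOn p (E \ {v})) (hC : ∀ i, IsConvexIn p (E \ {v}) (C i \ {v})) :
    ∃ q : α → ℤ, InjOn q E ∧ IsConvexIn q E A ∧ ∀ i, IsConvexIn q E (C i) := by
  classical
  obtain ⟨⟨hvA, hvB⟩, -⟩ := (hY i₀).common
  obtain ⟨w, hwC, hwA, hwB⟩ := (hY i₀).exists_C_only
  have hwE := (hY i₀).subset_C hwC
  have hwv : w ≠ v := fun he => hwA (by rw [he]; exact hvA)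
  -- The blocks are A, v, the middle points, B. Every C i contains v and the whole middle block, so
  -- it stays an interval, as does A; B need not.
  obtain ⟨q, hq⟩ := exists_lexicographic_order (hY i₀).finite p
    (fun x => if x = v then 1 else if x ∈ A then 0 else if x ∈ B then 3 else 2)
  have hAB : ∀ x, x ∈ A → x ∈ B → x = v := fun x => (hY i₀).eq_common
  have hAE := (hY i₀).subset_A
  have hW : ∀ i, ∀ t ∈ E, t ∉ A → t ∉ B → t ∈ C i := fun i t ht htA htB =>
    (((hY i).no_isolated t ht).resolve_left htA).resolve_left htB
  refine ⟨q, ?_, ⟨hAE, ?_⟩, fun i => ⟨(hY i).subset_C, ?_⟩⟩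
  · intro x hx y hy hxy
    have h1 := (hq x hx y hy).1 hxy.le
    have h2 := (hq y hy x hx).1 hxy.ge
    have h4 : x ≠ v → y ≠ v → p x = p y → x = y := fun h h' => hp ⟨hx, h⟩ ⟨hy, h'⟩
    split_ifs at h1 h2 <;> grind
  · intro y hy z hz t ht h1 h2
    rw [hq t ht z (hAE hz)] at h2
    split_ifs at h2 <;> grind
  · intro y hy z hz t ht h1 h2
    have hyE := (hY i).subset_C hy
    have hzE := (hY i).subset_C hz
    have hvC := (hY i).common.2
    rw [hq y hyE t ht] at h1
    rw [hq t ht z hzE] at h2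
    have hwi := hW i w hwE hwA hwB
    by_cases htv : t = v
    · rwa [htv]
    by_cases htA : t ∈ A
    · have h3 : y ∈ A ∧ y ≠ v ∧ p y ≤ p t := by
        split_ifs at h1 <;> grind
      obtain ⟨x, hx⟩ := (hY i).swap.exists_mem_A
      have h4 := (hmid t htA htv w hwE hwA hwB x hx.1 hx.2).1
      exact ((hC i).2 y ⟨hy, h3.2.1⟩ w ⟨hwi, hwv⟩ t ⟨ht, htv⟩ h3.2.2 h4.le).1
    by_cases htB : t ∈ B
    · have h3 : z ∈ B ∧ z ≠ v ∧ p t ≤ p z := by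
        split_ifs at h2 <;> grind
      obtain ⟨x, hx⟩ := (hY i).exists_mem_A
      have h4 := (hmid x hx.1 hx.2 w hwE hwA hwB t htB htv).2
      exact ((hC i).2 w ⟨hwi, hwv⟩ z ⟨hz, h3.2.1⟩ t ⟨ht, htv⟩ h4.le h3.2.2).1
    · exact hW i t ht htA htB

/-- The point `v` can be put between `A` and `B` when a point outside `A ∪ B` is deleted. -/
lemma IsMiddle.exists_order_sdiff (hmid : IsMiddle p v E A B)
    (hY : ∀ i, IsLabelledY d (a i) (b i) v E A B (C i))
    (i₀ : ι) (hp : InjOn p (E \ {v})) (hC : ∀ i, IsConvexIn p (E \ {v}) (C i \ {v})) (hxE : x ∈ E)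
    (hxA : x ∉ A) (hxB : x ∉ B) :
    ∃ q : α → ℤ, InjOn q E ∧ IsConvexIn q E A ∧ IsConvexIn q E B ∧
      ∀ i, d < (C i).ncard → IsConvexIn q (E \ {x}) (C i \ {x}) := by
  classical
  obtain ⟨⟨hvA, hvB⟩, -⟩ := (hY i₀).common
  have hxv : x ≠ v := fun he => hxA (by rw [he]; exact hvA)
  -- The blocks are A, v, B, and last the points outside A ∪ B. If |C i| > d, then x is the only
  -- point in the last block, so its deletion leaves C i inside A ∪ B.
  obtain ⟨q, hq⟩ := exists_lexicographic_order (hY i₀).finite p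
    (fun x => if x = v then 1 else if x ∈ A then 0 else if x ∈ B then 2 else 3)
  have hAB : ∀ x, x ∈ A → x ∈ B → x = v := fun x => (hY i₀).eq_common
  have hAE := (hY i₀).subset_A
  have hBE := (hY i₀).subset_B
  have hW : ∀ i, ∀ t ∈ E, t ∉ A → t ∉ B → t ∈ C i := fun i t ht htA htB =>
    (((hY i).no_isolated t ht).resolve_left htA).resolve_left htB
  refine ⟨q, ?_, ⟨hAE, ?_⟩, ⟨hBE, ?_⟩, fun i hlt =>
    ⟨sdiff_subset_sdiff_left (hY i).subset_C, ?_⟩⟩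
  · intro x hx y hy hxy
    have h1 := (hq x hx y hy).1 hxy.le
    have h2 := (hq y hy x hx).1 hxy.ge
    have h4 : x ≠ v → y ≠ v → p x = p y → x = y := fun h h' => hp ⟨hx, h⟩ ⟨hy, h'⟩
    split_ifs at h1 h2 <;> grind
  · intro y hy z hz t ht h1 h2
    rw [hq t ht z (hAE hz)] at h2
    split_ifs at h2 <;> grind
  · intro y hy z hz t ht h1 h2
    rw [hq y (hBE hy) t ht] at h1
    rw [hq t ht z (hBE hz)] at h2
    split_ifs at h1 h2 <;> grind
  · have hxC := hW i x hxE hxA hxB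
    obtain ⟨w, hw⟩ := ncard_eq_one.1 ((hY i).large hlt)
    have hxw : x = w := by
      have : x ∈ C i \ (A ∪ B) := ⟨hxC, by simp [hxA, hxB]⟩
      rwa [hw] at this
    rintro y ⟨hy, hyx⟩ z ⟨hz, hzx⟩ t ⟨ht, htx⟩ h1 h2
    refine ⟨?_, htx⟩
    have hyE := (hY i).subset_C hy
    have hzE := (hY i).subset_C hz
    have hvC := (hY i).common.2
    rw [hq y hyE t ht] at h1
    rw [hq t ht z hzE] at h2
    have hAB' : t ∈ A ∨ t ∈ B := by
      by_contra hcon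
      rw [not_or] at hcon
      have : t ∈ C i \ (A ∪ B) := ⟨hW i t ht hcon.1 hcon.2, by simp [hcon.1, hcon.2]⟩
      rw [hw] at this
      exact htx (this.trans hxw.symm)
    have hzAB : z ∈ A ∨ z ∈ B := by
      by_contra hcon
      rw [not_or] at hcon
      have : z ∈ C i \ (A ∪ B) := ⟨hz, by simp [hcon.1, hcon.2]⟩
      rw [hw] at this
      exact hzx (this.trans hxw.symm)
    by_cases htv : t = v
    · rwa [htv]
    by_cases htA : t ∈ A
    · have h3 : y ∈ A ∧ y ≠ v ∧ p y ≤ p t := by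
        split_ifs at h1 <;> grind
      obtain ⟨u, hu⟩ := (hY i).swap.exists_mem_A
      have h4 := (hmid t htA htv x hxE hxA hxB u hu.1 hu.2).1
      exact ((hC i).2 y ⟨hy, h3.2.1⟩ x ⟨hxC, hxv⟩ t ⟨ht, htv⟩ h3.2.2 h4.le).1
    · have htB : t ∈ B := hAB'.resolve_left htA
      have h3 : z ∈ B ∧ z ≠ v ∧ p t ≤ p z := by
        split_ifs at h2 <;> grind
      obtain ⟨u, hu⟩ := (hY i).exists_mem_A
      have h4 := (hmid u hu.1 hu.2 x hxE hxA hxB t htB htv).2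
      exact ((hC i).2 x ⟨hxC, hxv⟩ z ⟨hz, h3.2.1⟩ t ⟨ht, htv⟩ h4.le h3.2.2).1

end Sufficiency

/-! ### One-element minors and the theorem -/

section ExcludedMinors

open scoped Matroid

variable {α ι : Type*} {M : Matroid α} {d : ℕ} {v : α} {A B : Set α} {C : ι → Set α} {a b : ι → ℕ}

/-- The contraction is assumed in order to cover coloops, for which deletion and contraction agree.
-/
lemma isIntervalDetermined_deleteElem_of_contractElem [M.Finite] (hrank : M.eRank = d)
    (hp : IsPaving M) {x : α} (hx : x ∈ M.E) (hc : IsIntervalDetermined (M ／ {x}))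
    (h : ∃ p : α → ℤ, InjOn p (M.E \ {x}) ∧ ∀ H ∈ dependentHyperplanes M, d ≤ (H \ {x}).ncard →
      IsConvexIn p (M.E \ {x}) (H \ {x})) : IsIntervalDetermined (M ＼ {x}) := by
  by_cases hcol : M.IsColoop x
  · rwa [← contractElem_eq_deleteElem_of_isColoop hcol]
  · obtain ⟨p, hpi, hpc⟩ := h
    exact isIntervalDetermined_deleteElem hrank hp (coindep_singleton hx hcol) p hpi hpc

lemma IsConvexIn.sdiff_singleton {p : α → ℤ} {E X : Set α} (h : IsConvexIn p E X) (x : α) :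
    IsConvexIn p (E \ {x}) (X \ {x}) := by
  have := h.inter_of_subset (E' := E \ {x}) sdiff_subset
  rwa [← inter_sdiff_assoc, inter_eq_left.2 h.1] at this

lemma IsLabelledY.ncard_sdiff_lt {a b : ℕ} {E A B C : Set α} (h : IsLabelledY d a b v E A B C)
    {x : α} (hx : x ∈ A) : (A \ {x}).ncard < d := by
  have := ncard_sdiff_singleton_add_one hx (h.finite.subset h.subset_A)
  rw [h.card_A] at this
  omega

/-- The one-element minors at points of `A` are interval. -/
lemma IsMiddle.isIntervalDetermined_of_mem [M.Finite] (hrank : M.eRank = d) (hp : IsPaving M)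
    (hedges : dependentHyperplanes M = {A, B} ∪ range C)
    (hY : ∀ i, IsLabelledY d (a i) (b i) v M.E A B (C i)) (i₀ : ι) {p : α → ℤ}
    (hpi : InjOn p (M.E \ {v})) (hC : ∀ i, IsConvexIn p (M.E \ {v}) (C i \ {v}))
    (hmid : IsMiddle p v M.E A B) {x : α} (hx : x ∈ A) (hxv : x ≠ v) :
    IsIntervalDetermined (M ／ {x}) ∧ IsIntervalDetermined (M ＼ {x}) := by
  have hd : 2 ≤ d := by have := (hY i₀).a_le; omega
  have hxE := (hY i₀).subset_A hx
  have hxB : x ∉ B := fun hxB => hxv ((hY i₀).eq_common hx hxB)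
  obtain ⟨q, hqi, hqA, hqC⟩ := hmid.exists_order hY i₀ hpi hC
  -- The mirrored order sacrifices A instead of B. It serves the deletion, where A drops to d - 1
  -- points; `q` serves the contraction, where B does not contain x.
  obtain ⟨r, hri, hrB, hrC⟩ := hmid.neg.exists_order (fun i => (hY i).swap) i₀
    (fun x hx y hy hxy => hpi hx hy (neg_inj.1 hxy)) (fun i => (hC i).neg)
  have hc : IsIntervalDetermined (M ／ {x}) := by
    refine isIntervalDetermined_contractElem hrank hp hd hxE q (hqi.mono sdiff_subset) ?_
    rw [hedges]
    rintro H ((rfl | rfl) | ⟨i, rfl⟩) hxH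
    · exact hqA.sdiff_singleton x
    · exact absurd hxH hxB
    · exact (hqC i).sdiff_singleton x
  refine ⟨hc, isIntervalDetermined_deleteElem_of_contractElem hrank hp hxE hc
    ⟨r, hri.mono sdiff_subset, ?_⟩⟩
  rw [hedges]
  rintro H ((rfl | rfl) | ⟨i, rfl⟩) hcard
  · exact absurd hcard ((hY i₀).ncard_sdiff_lt hx).not_ge
  · exact hrB.sdiff_singleton x
  · exact (hrC i).sdiff_singleton x

/-- Conditions 1 and 2 imply that all proper minors are interval positroids. -/
lemma IsMiddle.isIntervalPositroid_of_isStrictMinor [M.Finite] (hrank : M.eRank = d)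
    (hp : IsPaving M) (hedges : dependentHyperplanes M = {A, B} ∪ range C)
    (hY : ∀ i, IsLabelledY d (a i) (b i) v M.E A B (C i)) (i₀ : ι) {p : α → ℤ}
    (hpi : InjOn p (M.E \ {v})) (hpc : ∀ H ∈ dependentHyperplanes M,
      IsConvexIn p (M.E \ {v}) (H \ {v}))
    (hmid : IsMiddle p v M.E A B) {N : Matroid α} (hN : N <m M) : IsIntervalPositroid N := by
  have hd : 2 ≤ d := by have := (hY i₀).a_le; omega
  have hC : ∀ i, IsConvexIn p (M.E \ {v}) (C i \ {v}) := fun i =>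
    hpc _ (by rw [hedges]; exact Or.inr ⟨i, rfl⟩)
  suffices h : ∀ x ∈ M.E, IsIntervalDetermined (M ／ {x}) ∧ IsIntervalDetermined (M ＼ {x}) from
    _root_.isIntervalPositroid_of_isStrictMinor (fun x hx => (h x hx).2) (fun x hx => (h x hx).1) hN
  intro x hx
  by_cases hxv : x = v
  · subst hxv
    have hc : IsIntervalDetermined (M ／ {x}) :=
      isIntervalDetermined_contractElem hrank hp hd hx p hpi fun H hH _ => hpc H hH
    exact ⟨hc, isIntervalDetermined_deleteElem_of_contractElem hrank hp hx hc
      ⟨p, hpi, fun H hH _ => hpc H hH⟩⟩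
  by_cases hxA : x ∈ A
  · exact hmid.isIntervalDetermined_of_mem hrank hp hedges hY i₀ hpi hC hxA hxv
  by_cases hxB : x ∈ B
  · exact hmid.neg.isIntervalDetermined_of_mem hrank hp (by rw [hedges, pair_comm])
      (fun i => (hY i).swap) i₀ (fun x hx y hy hxy => hpi hx hy (neg_inj.1 hxy))
      (fun i => (hC i).neg) hxB hxv
  obtain ⟨q, hqi, hqA, hqC⟩ := hmid.exists_order hY i₀ hpi hC
  obtain ⟨r, hri, hrA, hrB, hrC⟩ := hmid.exists_order_sdiff hY i₀ hpi hC hx hxA hxB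
  have hc : IsIntervalDetermined (M ／ {x}) := by
    refine isIntervalDetermined_contractElem hrank hp hd hx q (hqi.mono sdiff_subset) ?_
    rw [hedges]
    rintro H ((rfl | rfl) | ⟨i, rfl⟩) hxH
    · exact absurd hxH hxA
    · exact absurd hxH hxB
    · exact (hqC i).sdiff_singleton x
  refine ⟨hc, isIntervalDetermined_deleteElem_of_contractElem hrank hp hx hc
    ⟨r, hri.mono sdiff_subset, ?_⟩⟩
  rw [hedges]
  rintro H ((rfl | rfl) | ⟨i, rfl⟩) hcard
  · exact hrA.sdiff_singleton x
  · exact hrB.sdiff_singleton x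
  -- Since x lies in C i, keeping d points after the deletion means |C i| > d.
  · refine hrC i ?_
    have hxC : x ∈ C i := (((hY i).no_isolated x hx).resolve_left hxA).resolve_left hxB
    have := ncard_sdiff_singleton_add_one hxC ((hY i).finite.subset (hY i).subset_C)
    omega

/-- A paving matroid three of whose edges form a clutter `Y_{a,b;d}` is not an interval
positroid. -/
lemma IsLabelledY.not_isIntervalPositroid [M.Finite] (hrank : M.eRank = d) (hp : IsPaving M)
    {a b : ℕ} {C : Set α} (hY : IsLabelledY d a b v M.E A B C) (hA : A ∈ dependentHyperplanes M)
    (hB : B ∈ dependentHyperplanes M) (hC : C ∈ dependentHyperplanes M) :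
    ¬ IsIntervalPositroid M := by
  intro hM
  have hd : 2 ≤ d := by have := hY.a_le; omega
  obtain ⟨p, -, h⟩ := exists_order_of_delete hrank hp hd (D := ∅)
    (by rw [Matroid.delete_empty]; exact hM.isIntervalDetermined)
  simp only [sdiff_empty] at h
  have hcard := (isPavingSystem_dependentHyperplanes hrank hp (by omega)).card
  obtain ⟨⟨hvA, hvB⟩, hvC⟩ := hY.common
  obtain ⟨x, hx, hxB, hxC⟩ := hY.exists_A_only
  obtain ⟨y, hy, hyA, hyC⟩ := hY.exists_B_only
  obtain ⟨z, hz, hzA, hzB⟩ := hY.exists_C_only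
  exact false_of_three_private (h A hA (hcard A hA)) (h B hB (hcard B hB)) (h C hC (hcard C hC))
    hvA hvB hvC hx hxB hxC hy hyA hyC hz hzA hzB

/-- The deletions and contractions of an excluded minor give interval orders. -/
lemma IsExcludedMinorOfIntervalPositroids.hasIntervalMinors [M.Finite]
    (hM : IsExcludedMinorOfIntervalPositroids M) (hrank : M.eRank = d) (hp : IsPaving M)
    (hd : 3 ≤ d) : HasIntervalMinors d M.E (dependentHyperplanes M) := by
  have hne : ∀ x ∈ M.E, ∀ N : Matroid α, N.E = M.E \ {x} → N ≠ M := by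
    rintro x hx N hN rfl
    rw [hN] at hx
    exact hx.2 rfl
  refine ⟨isPavingSystem_dependentHyperplanes hrank hp (by omega), fun x hx => ?_, fun x hx => ?_⟩
  · refine exists_order_of_delete hrank hp (by omega) (hM.2 _ ?_).isIntervalDetermined
    rw [Matroid.isStrictMinor_iff_isMinor_ne]
    refine ⟨⟨∅, {x}, by rw [Matroid.contract_empty]⟩, hne x hx _ rfl⟩
  · refine exists_order_of_contract hrank hp hd hx (hM.2 _ ?_).isIntervalDetermined
    rw [Matroid.isStrictMinor_iff_isMinor_ne]
    refine ⟨⟨{x}, ∅, by rw [Matroid.delete_empty]⟩, hne x hx _ rfl⟩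

/-- This separates the three edges being renamed from the untouched ones, so that renaming visibly
keeps the edge set. -/
lemma pair_union_range_update {β : Type*} [DecidableEq ι] (x y z : β) (f : ι → β) (i : ι) :
    {x, y} ∪ range (Function.update f i z) = {x, y, z} ∪ f '' {i}ᶜ := by
  have : range (Function.update f i z) = {z} ∪ f '' {i}ᶜ := by
    ext w
    constructor
    · rintro ⟨j, rfl⟩
      by_cases hj : j = i
      · subst hj; simp
      · exact Or.inr ⟨j, hj, by rw [Function.update_of_ne hj]⟩
    · rintro (rfl | ⟨j, hj, rfl⟩)
      · exact ⟨i, by simp⟩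
      · exact ⟨j, by rw [Function.update_of_ne hj]⟩
  rw [this, ← union_assoc, insert_union, singleton_union]

end ExcludedMinors

theorem mainTheorem5 {α : Type*} (M : Matroid α) [M.Finite] (d m : ℕ) (hm : 3 ≤ m)
    (hrank : M.eRank = d) (hpaving : IsPaving M)
    (A B : Set α) (C : Fin m → Set α)
    (hAB : A ≠ B) (hAC : ∀ i, A ≠ C i) (hBC : ∀ i, B ≠ C i) (hC : Function.Injective C)
    (hedges : dependentHyperplanes M = {A, B} ∪ range C) (v : α) :
    (IsExcludedMinorOfIntervalPositroids M → ∀ a₁ b₁ : ℕ,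
      (IsY d a₁ b₁ v M.E {A, B, C ⟨0, by omega⟩} ↔
        ∃ A' B' C₁' : Set α, ({A', B', C₁'} : Set (Set α)) = {A, B, C ⟨0, by omega⟩} ∧
          ∃ a b : Fin m → ℕ, a ⟨0, by omega⟩ = a₁ ∧ b ⟨0, by omega⟩ = b₁ ∧
            IsYFamily d a b v M.E A' B' (Function.update C ⟨0, by omega⟩ C₁'))) ∧
    ((∃ a b : Fin m → ℕ, IsYFamily d a b v M.E A B C) →
      IsExcludedMinorOfIntervalPositroids M) := by
  have hA : A ∈ dependentHyperplanes M := by rw [hedges]; simp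
  have hB : B ∈ dependentHyperplanes M := by rw [hedges]; simp
  have hCm : ∀ i, C i ∈ dependentHyperplanes M := by intro i; rw [hedges]; simp
  constructor
  · intro hM a₁ b₁
    constructor
    · rintro ⟨A₀, B₀, C₀, hset, hY⟩
      have hd : 3 ≤ d := by have := hY.a_le; omega
      have h := hM.hasIntervalMinors hrank hpaving hd
      have hmem : ∀ X ∈ ({A₀, B₀, C₀} : Set (Set α)), X ∈ dependentHyperplanes M := by
        rw [← hset]
        rintro X (rfl | rfl | rfl)
        exacts [hA, hB, hCm _]
      obtain ⟨A', B', C', h1, h2, h3, h4, h5⟩ :=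
        h.exists_isYFamily hY (hmem _ (by simp)) (hmem _ (by simp)) (hmem _ (by simp))
      rw [← hset] at h1 h3
      have hall : {A', B'} ∪ range (Function.update C ⟨0, by omega⟩ C')
          = dependentHyperplanes M := by
        rw [hedges, pair_union_range_update, h1, ← pair_union_range_update,
          Function.update_eq_self]
      refine ⟨A', B', C', h1, fun i => if i = ⟨0, by omega⟩ then a₁ else ((A' ∩ C i) \ B').ncard,
        fun i => if i = ⟨0, by omega⟩ then b₁ else ((C i ∩ B') \ A').ncard, by simp, by simp, ?_, ?_⟩
      · intro i
        by_cases hi : i = ⟨0, by omega⟩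
        · subst hi
          simpa using h2
        · rw [Function.update_of_ne hi]
          simp only [hi, if_false]
          refine h3 _ (hCm i) ?_
          rintro (he | he | he)
          · exact hAC i he.symm
          · exact hBC i he.symm
          · exact hi (hC he)
      · rw [hall]
        exact ⟨h4, h5⟩
    · rintro ⟨A', B', C', hset, a, b, rfl, rfl, h, -⟩
      refine ⟨A', B', C', hset.symm, ?_⟩
      simpa using h ⟨0, by omega⟩
  · rintro ⟨a, b, hY, ⟨-, hint⟩, -⟩
    -- Two distinct, hence incomparable, sets C i are enough to force the middle position.
    have hne : (⟨0, by omega⟩ : Fin m) ≠ ⟨1, by omega⟩ := by simp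
    have hd : 3 ≤ d := by have := (hY ⟨0, by omega⟩).a_le; omega
    have hanti := (isPavingSystem_dependentHyperplanes hrank hpaving (by omega)).isAntichain
    obtain ⟨p, hpi, hpc⟩ := hint.exists_order
    rw [← hedges] at hpc
    have hpc' : ∀ H ∈ dependentHyperplanes M, IsConvexIn p (M.E \ {v}) (H \ {v}) :=
      fun H hH => hpc _ (mem_image_of_mem _ hH)
    refine ⟨(hY ⟨0, by omega⟩).not_isIntervalPositroid hrank hpaving hA hB (hCm _), fun N hN => ?_⟩
    rcases exists_isMiddle_of_ne hY (hanti (hCm _) (hCm _) (hC.ne hne))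
      (hanti (hCm _) (hCm _) (hC.ne hne.symm)) (hpc' A hA) (hpc' B hB)
      (fun i => hpc' _ (hCm i)) with hmid | hmid
    · exact hmid.isIntervalPositroid_of_isStrictMinor hrank hpaving hedges hY ⟨0, by omega⟩ hpi hpc' hN
    · exact hmid.isIntervalPositroid_of_isStrictMinor hrank hpaving (by rw [hedges, pair_comm])
        (fun i => (hY i).swap) ⟨0, by omega⟩ hpi hpc' hN
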